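/- Conventions. A $\mathbb Z^2$-subshift is a closed translation-invariant set $Y\subset\Sigma^{\mathbb Z^2}$, $\Sigma$ a finite discrete alphabet, with the action $(T^uy)(v)=y(u+v)$. A ray is a set $\rho(w)=\{tw: t\ge 0\}$, $0\ne w\in\mathbb R^2$; the space of rays is identified with the circle $S^1$. Let $L=\mathbb Rw$, $L(r)=\{z\in\mathbb Z^2: d(z,L)\le r\}$ and $H^+(L)=\{z\in\mathbb R^2: (w,z)\text{ is a positively oriented basis}\}$. The ray $\rho(w)$ is expansive for $Y$ if for some $r>0$ any two elements of $Y$ that agree on $L(r)$ agree on $H^+(L)\cap\mathbb Z^2$. A shift is an infinite closed set $X\subset\Sigma^{\mathbb Z}$ ($\Sigma$ finite) invariant under the left shift $\sigma$; an endomorphism of $X$ is a continuous surjection $\varphi:X\to X$ commuting with $\sigma$. Its spacetime $\mathcal U(\varphi)$ is the $\mathbb Z^2$-subshift of all $z\in\Sigma^{\mathbb Z^2}$ whose rows $z(\cdot,j)$, $j\in\mathbb Z$, lie in $X$ and satisfy $z(\cdot,j+1)=\varphi(z(\cdot,j))$. Let $W^+(n,\varphi)$ be the least $m\in\mathbb Z$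 such that $\varphi^n(x),\varphi^n(y)$ agree on $[m,\infty)$ whenever $x,y\in X$ agree on $[0,\infty)$; let $W^-(n,\varphi)$ be the greatest $m$ such that $\varphi^n(x),\varphi^n(y)$ agree on $(-\infty,m]$ whenever $x,y\in X$ agree on $(-\infty,0]$; and let $\alpha^\pm(\varphi)=\lim_{n\to\infty}W^\pm(n,\varphi)/n$. The edges of the asymptotic light cone $\mathcal A(\varphi)=\{(u,v):\alpha^-(\varphi)v\le u\le\alpha^+(\varphi)v\}$ are the lines $u=\alpha^-(\varphi)v$ and $u=\alpha^+(\varphi)v$ (which may coincide). A $\mathbb Z^2$-isomorphism $\Psi:Y\to Z$ is a homeomorphism together with a matrix $M\in GL_2(\mathbb Z)$ such that $\Psi(T^uy)=T^{Mu}\Psi(y)$ for all $u\in\mathbb Z^2$, $y\in Y$; it is orientation preserving if $\det M=1$, and for a ray $\rho$ one writes $\Psi(\rho)=M\rho$. Proposition. Let $Y$ be a $\mathbb Z^2$-subshift and let $\mathcal E\subset S^1$ be its set of expansive rays. Let $C$ be a connected component of $\mathcal E$ and suppose that $C$ is an arc with endpoints $\rho_1,\rho_2$, i.e. that the boundary of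 $C$ in $S^1$ is $\{\rho_1,\rho_2\}$. Then there are an (infinite) shift $X$, an endomorphism $\varphi$ of $X$ for which all the numbers $W^\pm(n,\varphi)$ exist and the limits $\alpha^\pm(\varphi)$ exist and are finite, and an orientation-preserving $\mathbb Z^2$-isomorphism $\Psi:Y\to\mathcal U(\varphi)$ such that $$\{\operatorname{span}\Psi(\rho_1),\operatorname{span}\Psi(\rho_2)\}=\{\text{the edges of }\mathcal A(\varphi)\}.$$ -/

import Mathlib

open Set Filter Topology
open SymbolicDynamics.FullShift (Subshift)

namespace LightCone

noncomputable section

/-! ### Subshifts and their endomorphisms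

A subshift over the group `G` (here `ℤ` or `ℤ × ℤ`) on a finite discrete alphabet `A` is Mathlib's
`Subshift A G`: a closed subset of `G → A` invariant under all the translations
`(T^u x)(v) = x (u + v)`. -/

/-- The translation `T^u` restricted to a subshift. -/
def translate {A G : Type*} [TopologicalSpace A] [AddMonoid G] (X : Subshift A G) (u : G) :
    X.carrier → X.carrier :=
  (X.mapsTo u).restrict _ _ _

/-- An endomorphism of a shift `X`: a continuous surjection `X → X` commuting with the left
shift. -/
structure Endo {A : Type*} [TopologicalSpace A] (X : Subshift A ℤ) where
  toFun : X.carrier → X.carrier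
  continuous : Continuous toFun
  surjective : Function.Surjective toFun
  commutes : ∀ x, toFun (translate X 1 x) = translate X 1 (toFun x)

/-! ### The spacetime -/

/-- The `j`-th row of a coloring of `ℤ²`. -/
def row {A : Type*} (z : ℤ × ℤ → A) (j : ℤ) : ℤ → A := fun i => z (i, j)

/-- The colorings of `ℤ²` all of whose rows lie in `X`, row `j + 1` being `φ` of row `j` for every
`j ∈ ℤ`. -/
def spacetimeSet {A : Type*} [TopologicalSpace A] {X : Subshift A ℤ} (φ : Endo X) :
    Set (ℤ × ℤ → A) :=
  {z | ∀ j : ℤ, ∃ x : X.carrier, row z j = x ∧ row z (j + 1) = φ.toFun x}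

theorem isClosed_spacetimeSet {A : Type*} [TopologicalSpace A] [DiscreteTopology A] [Finite A]
    {X : Subshift A ℤ} (φ : Endo X) : IsClosed (spacetimeSet φ) := by
  have hc : CompactSpace X.carrier := isCompact_iff_compactSpace.mp X.isClosed.isCompact
  have hcont : Continuous fun x : X.carrier => ((x : ℤ → A), (φ.toFun x : ℤ → A)) :=
    continuous_subtype_val.prodMk (continuous_subtype_val.comp φ.continuous)
  have hcl : IsClosed (range fun x : X.carrier => ((x : ℤ → A), (φ.toFun x : ℤ → A))) :=
    (isCompact_range hcont).isClosed
  have heq : spacetimeSet φ = ⋂ j : ℤ, (fun z : ℤ × ℤ → A => (row z j, row z (j + 1))) ⁻¹'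
      (range fun x : X.carrier => ((x : ℤ → A), (φ.toFun x : ℤ → A))) := by
    ext z
    simp only [spacetimeSet, mem_ofPred_eq, mem_iInter, mem_preimage, mem_range, Prod.mk.injEq]
    exact forall_congr' fun j => exists_congr fun x =>
      ⟨fun h => ⟨h.1.symm, h.2.symm⟩, fun h => ⟨h.1.symm, h.2.symm⟩⟩
  rw [heq]
  refine isClosed_iInter fun j => hcl.preimage ?_
  unfold row
  fun_prop

theorem Endo.commutes_translate {A : Type*} [TopologicalSpace A] {X : Subshift A ℤ} (φ : Endo X)
    (n : ℤ) (x : X.carrier) : φ.toFun (translate X n x) = translate X n (φ.toFun x) := by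
  have h0 : ∀ y : X.carrier, translate X 0 y = y := fun y => by
    apply Subtype.ext; funext i; simp [translate]
  have hadd : ∀ (a b : ℤ) (y : X.carrier),
      translate X a (translate X b y) = translate X (b + a) y := fun a b y => by
    apply Subtype.ext; funext i; simp [translate, add_assoc]
  induction n using Int.induction_on generalizing x with
  | zero => rw [h0, h0]
  | succ k ih =>
    rw [← hadd 1 k x, φ.commutes, ih, hadd]
  | pred k ih =>
    have h1 : φ.toFun (translate X 1 (translate X (-(k : ℤ) - 1) x)) =
        translate X (-(k : ℤ)) (φ.toFun x) := by
      rw [hadd, sub_add_cancel, ih]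
    rw [φ.commutes] at h1
    have h2 := congrArg (translate X (-1)) h1
    rw [hadd, hadd, add_neg_cancel, h0] at h2
    rw [h2, sub_eq_add_neg]

/-- The spacetime `𝒰(φ)` of an endomorphism, as a `ℤ²`-subshift. -/
def spacetime {A : Type*} [TopologicalSpace A] [DiscreteTopology A] [Finite A]
    {X : Subshift A ℤ} (φ : Endo X) : Subshift A (ℤ × ℤ) where
  carrier := spacetimeSet φ
  isClosed := isClosed_spacetimeSet φ
  mapsTo := by
    rintro ⟨a, b⟩ z hz j
    obtain ⟨x, hx, hx'⟩ := hz (b + j)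
    refine ⟨translate X a x, ?_, ?_⟩
    · rw [translate, MapsTo.val_restrict_apply, ← hx]
      rfl
    · rw [φ.commutes_translate, translate, MapsTo.val_restrict_apply, ← hx', add_assoc]
      rfl

/-! ### The asymptotic light cone -/

/-- The set `P ⊆ ℤ` codes the set `Q ⊆ ℤ` for the map `f`: if `x`, `y` agree on `P`, then `f x`,
`f y` agree on `Q`. -/
def MapCodes {A : Type*} [TopologicalSpace A] {X : Subshift A ℤ} (f : X.carrier → X.carrier)
    (P Q : Set ℤ) : Prop :=
  ∀ x y : X.carrier, EqOn (x : ℤ → A) y P → EqOn (f x : ℤ → A) (f y) Q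

/-- The integers `m` such that `[0, ∞)` codes `[m, ∞)` for `φ^n`. -/
def rightCoded {A : Type*} [TopologicalSpace A] {X : Subshift A ℤ} (φ : Endo X) (n : ℕ) : Set ℤ :=
  {m | MapCodes φ.toFun^[n] (Ici 0) (Ici m)}

/-- The integers `m` such that `(-∞, 0]` codes `(-∞, m]` for `φ^n`. -/
def leftCoded {A : Type*} [TopologicalSpace A] {X : Subshift A ℤ} (φ : Endo X) (n : ℕ) : Set ℤ :=
  {m | MapCodes φ.toFun^[n] (Iic 0) (Iic m)}

/-- `W⁺(n, φ)`: the least `m` such that `[0, ∞)` codes `[m, ∞)` for `φ^n`. -/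
def Wplus {A : Type*} [TopologicalSpace A] {X : Subshift A ℤ} (φ : Endo X) (n : ℕ) : ℤ :=
  sInf (rightCoded φ n)

/-- `W⁻(n, φ)`: the greatest `m` such that `(-∞, 0]` codes `(-∞, m]` for `φ^n`. -/
def Wminus {A : Type*} [TopologicalSpace A] {X : Subshift A ℤ} (φ : Endo X) (n : ℕ) : ℤ :=
  sSup (leftCoded φ n)

/-- `α⁺(φ) = lim W⁺(n, φ) / n`. -/
def alphaPlus {A : Type*} [TopologicalSpace A] {X : Subshift A ℤ} (φ : Endo X) : ℝ :=
  limUnder atTop fun n : ℕ => (Wplus φ n : ℝ) / n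

/-- `α⁻(φ) = lim W⁻(n, φ) / n`. -/
def alphaMinus {A : Type*} [TopologicalSpace A] {X : Subshift A ℤ} (φ : Endo X) : ℝ :=
  limUnder atTop fun n : ℕ => (Wminus φ n : ℝ) / n

/-- The extrema and limits in the definitions of `W⁺`, `W⁻`, `α⁺`, `α⁻` are all attained
respectively convergent, so that none of these numbers is a default value. -/
structure ConeWellDefined {A : Type*} [TopologicalSpace A] {X : Subshift A ℤ} (φ : Endo X) :
    Prop where
  isLeast : ∀ n, IsLeast (rightCoded φ n) (Wplus φ n)
  isGreatest : ∀ n, IsGreatest (leftCoded φ n) (Wminus φ n)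
  tendsto_plus : Tendsto (fun n : ℕ => (Wplus φ n : ℝ) / n) atTop (𝓝 (alphaPlus φ))
  tendsto_minus : Tendsto (fun n : ℕ => (Wminus φ n : ℝ) / n) atTop (𝓝 (alphaMinus φ))

/-- The Euclidean plane `ℝ²`. -/
abbrev Plane : Type := EuclideanSpace ℝ (Fin 2)

/-- The asymptotic light cone `𝒜(φ) = {(u, v) | α⁻(φ) v ≤ u ≤ α⁺(φ) v}`. -/
def asymptoticLightCone {A : Type*} [TopologicalSpace A] {X : Subshift A ℤ} (φ : Endo X) :
    Set Plane :=
  {p | alphaMinus φ * p 1 ≤ p 0 ∧ p 0 ≤ alphaPlus φ * p 1}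

/-- The edges of the asymptotic light cone `𝒜(φ)`: the two lines `u = α⁻(φ) v` and `u = α⁺(φ) v`
that bound it (a single line if `α⁻(φ) = α⁺(φ)`). -/
def lightConeEdges {A : Type*} [TopologicalSpace A] {X : Subshift A ℤ} (φ : Endo X) :
    Set (Submodule ℝ Plane) :=
  {Submodule.span ℝ {!₂[alphaMinus φ, 1]}, Submodule.span ℝ {!₂[alphaPlus φ, 1]}}

/-! ### Expansive rays of a `ℤ²`-subshift -/

/-- The standard inclusion `ℤ² ⊆ ℝ²`. -/
def toPlane (z : ℤ × ℤ) : Plane := !₂[(z.1 : ℝ), (z.2 : ℝ)]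

/-- The ray `ρ(w) = {t w | t ≥ 0}`. -/
def ray (w : Plane) : Set Plane := {p | ∃ t : ℝ, 0 ≤ t ∧ p = t • w}

/-- `L(r)`: the lattice points at distance at most `r` from the line `L` spanned by `w`. -/
def strip (w : Plane) (r : ℝ) : Set (ℤ × ℤ) :=
  {z | Metric.infDist (toPlane z) (Submodule.span ℝ {w} : Set Plane) ≤ r}

/-- The lattice points of the open half plane `H⁺(L)`, where `L` is the line spanned by `w`,
oriented by `w`: the points `z` such that `(w, z)` is a positively oriented basis of `ℝ²`. -/
def posHalfPlane (w : Plane) : Set (ℤ × ℤ) :=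
  {z | 0 < w 0 * (z.2 : ℝ) - w 1 * (z.1 : ℝ)}

/-- `P ⊆ ℤ²` codes `Q ⊆ ℤ²` in `Y`: the restriction to `P` of an element of `Y` extends uniquely
to `Q`. -/
def Codes {A : Type*} [TopologicalSpace A] (Y : Subshift A (ℤ × ℤ)) (P Q : Set (ℤ × ℤ)) : Prop :=
  ∀ η ∈ Y.carrier, ∀ ν ∈ Y.carrier, EqOn η ν P → EqOn η ν Q

/-- The ray spanned by `w ≠ 0` is expansive for `Y`: the line `L` containing it, oriented by `w`,
is positively expansive, i.e. some strip `L(r)` codes the half plane `H⁺(L)`. -/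
def IsExpansiveRay {A : Type*} [TopologicalSpace A] (Y : Subshift A (ℤ × ℤ)) (w : Plane) : Prop :=
  ∃ r : ℝ, 0 < r ∧ Codes Y (strip w r) (posHalfPlane w)

/-- The space of rays of `ℝ²`, i.e. the circle of unit vectors. -/
abbrev RayCircle : Type := Metric.sphere (0 : Plane) 1

/-- The set `ℰ` of expansive rays of `Y`, as a subset of the circle. -/
def expansiveRays {A : Type*} [TopologicalSpace A] (Y : Subshift A (ℤ × ℤ)) : Set RayCircle :=
  {ρ | IsExpansiveRay Y ρ}

/-! ### Isomorphisms of `ℤ²`-systems -/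

/-- The action of an integer matrix on `ℤ²`. -/
def latticeMap (M : Matrix (Fin 2) (Fin 2) ℤ) (u : ℤ × ℤ) : ℤ × ℤ :=
  (M 0 0 * u.1 + M 0 1 * u.2, M 1 0 * u.1 + M 1 1 * u.2)

/-- The action of an integer matrix on `ℝ²`. -/
def planeMap (M : Matrix (Fin 2) (Fin 2) ℤ) (p : Plane) : Plane :=
  !₂[(M 0 0 : ℝ) * p 0 + M 0 1 * p 1, (M 1 0 : ℝ) * p 0 + M 1 1 * p 1]

/-- An isomorphism of `ℤ²`-systems, where the preferred basis of `ℤ²` is allowed to change: a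
homeomorphism `Ψ` that intertwines the two translation actions up to an automorphism
`basisChange ∈ GL₂(ℤ)` of the acting group `ℤ²`. -/
structure Z2Iso {A B : Type*} [TopologicalSpace A] [TopologicalSpace B]
    (Y : Subshift A (ℤ × ℤ)) (Z : Subshift B (ℤ × ℤ)) where
  toHomeomorph : Y.carrier ≃ₜ Z.carrier
  basisChange : GL (Fin 2) ℤ
  map_translate : ∀ (u : ℤ × ℤ) (y : Y.carrier),
    toHomeomorph (translate Y u y) = translate Z (latticeMap basisChange u) (toHomeomorph y)

/-- The isomorphism preserves the orientation of `ℤ²` (recall that the notion of expansive ray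
depends on the orientation). -/
def Z2Iso.OrientationPreserving {A B : Type*} [TopologicalSpace A] [TopologicalSpace B]
    {Y : Subshift A (ℤ × ℤ)} {Z : Subshift B (ℤ × ℤ)} (Ψ : Z2Iso Y Z) : Prop :=
  (Ψ.basisChange : Matrix (Fin 2) (Fin 2) ℤ).det = 1

/-- The ray `Ψ(ρ)`, the image of the ray `ρ` under the linear map of `ℝ²` induced by `Ψ`. -/
def Z2Iso.mapRay {A B : Type*} [TopologicalSpace A] [TopologicalSpace B]
    {Y : Subshift A (ℤ × ℤ)} {Z : Subshift B (ℤ × ℤ)} (Ψ : Z2Iso Y Z) (ρ : RayCircle) :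
    Set Plane :=
  planeMap Ψ.basisChange '' ray ρ

end

end LightCone

/-! Write `area w z` for the determinant of `(w, z)`. By compactness, the ray of `w` is expansive
exactly when there is a finite certificate: a finite set `F` in the open half plane `area w < 0`
that codes the origin. Such an `F` regenerates a half plane from a band, layer by layer
(`codes_band`). One certificate serves all nearby directions, so the given component contains a
rational ray (`exists_rational_mem_component`).

A determinant-one change of basis makes this ray the positive horizontal one. A band of finite
height then codes the half plane above it, so after recoding by vertical blocks each row determines
the next, and `Y` becomes the spacetime of an endomorphism `φ` of the row shift `X`
(`exists_spacetimeIso`). If `X` were finite, so would `Y` be; then every ray would be expansive and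
the component, being the whole circle, would have no endpoints.

For infinite `X`, counting words gives `W⁻ ≤ W⁺` (`le_of_mem_coded`), so the extrema exist, and
Fekete's lemma gives the limits. It remains to see that the component of the horizontal ray for the
spacetime is the open cone `u > α⁻ v`, `u > α⁺ v`, whose boundary rays are those of `(α⁺, 1)` and
`-(α⁻, 1)`. Rays inside are expansive because some `W⁺(n)/n` or `W⁻(n)/n` is close enough to its
limit (`isExpansiveRay_of_cone`). A certificate at the boundary ray of `(α⁺, 1)` would give, for
every large `j`, a time `i`, not much before `j`, at which `W⁺(i) - α⁺ i` exceeds its value at `j`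
by an amount growing linearly in `|i - j|`. This quantity is nonnegative and sublinear, so that is
impossible (`false_of_escape`); the other boundary ray is symmetric. A connected set of expansive
rays meeting the cone thus cannot leave it (`connectedComponentIn_eq_coneRays`), and its two
boundary rays span the edges. -/

namespace LightCone

/-! ### Compactness and coding -/

/-- On a compact space, a discrete quantity determined by coordinates in `P` is determined by
finitely many of them. -/
theorem exists_finset_determining {S ι A B : Type*} [TopologicalSpace S] [CompactSpace S]
    [TopologicalSpace A] [DiscreteTopology A] [TopologicalSpace B] [DiscreteTopology B]
    {u : S → ι → A} {v : S → B} (hu : Continuous u) (hv : Continuous v) {P : Set ι}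
    (h : ∀ x y, EqOn (u x) (u y) P → v x = v y) :
    ∃ F : Finset ι, ↑F ⊆ P ∧ ∀ x y, EqOn (u x) (u y) F → v x = v y := by
  -- The pairs that `v` separates form a compact set, covered by the open sets of pairs differing at
  -- one coordinate of `P`; a finite subcover gives `F`.
  have hK : IsCompact {p : S × S | v p.1 ≠ v p.2} := by
    apply IsClosed.isCompact
    have : Continuous fun p : S × S => (v p.1, v p.2) := by fun_prop
    exact (isClosed_discrete {q : B × B | q.1 ≠ q.2}).preimage this
  obtain ⟨b, hbP, hbf, hb⟩ := hK.elim_finite_subcover_image (b := P)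
    (c := fun i => {p : S × S | u p.1 i ≠ u p.2 i}) (fun i _ => by
      have : Continuous fun p : S × S => (u p.1 i, u p.2 i) := by fun_prop
      exact (isOpen_discrete {q : A × A | q.1 ≠ q.2}).preimage this) (by
      intro p hp
      by_contra hcon
      simp only [mem_iUnion, not_exists, mem_ofPred_eq, not_not] at hcon
      exact hp (h _ _ fun i hi => hcon i hi))
  refine ⟨hbf.toFinset, by simpa using hbP, fun x y hxy => ?_⟩
  by_contra hne
  have := hb (show (x, y) ∈ {p : S × S | v p.1 ≠ v p.2} from hne)
  simp only [mem_iUnion] at this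
  obtain ⟨i, hi, hi'⟩ := this
  exact hi' (hxy (by simpa using hi))

instance {A G : Type*} [Finite A] [TopologicalSpace A] [AddMonoid G]
    (X : Subshift A G) : CompactSpace X.carrier :=
  isCompact_iff_compactSpace.mp X.isClosed.isCompact

@[simp]
theorem translate_apply {A G : Type*} [TopologicalSpace A] [AddMonoid G] (X : Subshift A G)
    (u v : G) (x : X.carrier) : (translate X u x : G → A) v = (x : G → A) (u + v) := rfl

theorem continuous_translate {A G : Type*} [TopologicalSpace A] [AddMonoid G] (X : Subshift A G)
    (u : G) : Continuous (translate X u) := by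
  refine Continuous.subtype_mk (continuous_pi fun v => ?_) _
  exact (continuous_apply (u + v)).comp continuous_subtype_val

theorem translate_translate {A G : Type*} [TopologicalSpace A] [AddMonoid G] (X : Subshift A G)
    (u v : G) (x : X.carrier) : translate X u (translate X v x) = translate X (v + u) x := by
  apply Subtype.ext; funext i; simp [add_assoc]

theorem translate_zero {A G : Type*} [TopologicalSpace A] [AddMonoid G] (X : Subshift A G)
    (x : X.carrier) : translate X 0 x = x := by
  apply Subtype.ext; funext i; simp

section Codes

variable {A : Type*} [TopologicalSpace A] {Y : Subshift A (ℤ × ℤ)}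

theorem codes_iff {P Q : Set (ℤ × ℤ)} : Codes Y P Q ↔
    ∀ x y : Y.carrier, EqOn (x : ℤ × ℤ → A) y P → EqOn (x : ℤ × ℤ → A) y Q :=
  ⟨fun h x y => h x x.2 y y.2, fun h x hx y hy => h ⟨x, hx⟩ ⟨y, hy⟩⟩

theorem Codes.mono {P P' Q Q' : Set (ℤ × ℤ)} (h : Codes Y P Q) (hP : P ⊆ P') (hQ : Q' ⊆ Q) :
    Codes Y P' Q' :=
  fun x hx y hy hxy => (h x hx y hy (hxy.mono hP)).mono hQ

theorem Codes.point {P : Set (ℤ × ℤ)} {p : ℤ × ℤ} (h : Codes Y P {p}) (x y : Y.carrier)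
    (u : ℤ × ℤ) (hxy : ∀ v ∈ P, (x : ℤ × ℤ → A) (u + v) = (y : ℤ × ℤ → A) (u + v)) :
    (x : ℤ × ℤ → A) (u + p) = (y : ℤ × ℤ → A) (u + p) :=
  codes_iff.1 h (translate Y u x) (translate Y u y) hxy rfl

theorem Codes.exists_finset [Finite A] [DiscreteTopology A] {P : Set (ℤ × ℤ)} {p : ℤ × ℤ}
    (h : Codes Y P {p}) : ∃ F : Finset (ℤ × ℤ), ↑F ⊆ P ∧ Codes Y F {p} := by
  obtain ⟨F, hF, hF'⟩ := exists_finset_determining (S := Y.carrier)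
    (u := fun x => (x : ℤ × ℤ → A)) (v := fun x => (x : ℤ × ℤ → A) p) continuous_subtype_val
    ((continuous_apply p).comp continuous_subtype_val) (P := P) (fun x y hxy => codes_iff.1 h x y hxy rfl)
  refine ⟨F, hF, codes_iff.2 fun x y hxy => ?_⟩
  rintro _ rfl
  exact hF' x y hxy

end Codes

/-! ### Signed area and distance to a line -/

/-- The signed area of the parallelogram spanned by `w` and the lattice point `z`. -/
def area (w : Plane) (z : ℤ × ℤ) : ℝ := w 0 * z.2 - w 1 * z.1

theorem area_add (w : Plane) (u v : ℤ × ℤ) : area w (u + v) = area w u + area w v := by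
  simp only [area, Prod.fst_add, Prod.snd_add]; push_cast; ring

theorem area_neg (w : Plane) (u : ℤ × ℤ) : area w (-u) = -area w u := by
  simp only [area, Prod.fst_neg, Prod.snd_neg]; push_cast; ring

theorem area_sub (w : Plane) (u v : ℤ × ℤ) : area w (u - v) = area w u - area w v := by
  rw [sub_eq_add_neg, area_add, area_neg]; ring

@[simp]
theorem area_zero (w : Plane) : area w 0 = 0 := by simp [area]

theorem area_nsmul (w : Plane) (n : ℕ) (u : ℤ × ℤ) : area w (n • u) = n * area w u := by
  rw [area, area, Prod.smul_fst, Prod.smul_snd, nsmul_eq_mul, nsmul_eq_mul]; push_cast; ring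

theorem norm_sq_plane (w : Plane) : ‖w‖ ^ 2 = w 0 ^ 2 + w 1 ^ 2 := by
  rw [EuclideanSpace.norm_sq_eq]; simp

theorem infDist_span {w : Plane} (hw : w ≠ 0) (z : ℤ × ℤ) :
    Metric.infDist (toPlane z) (Submodule.span ℝ {w} : Set Plane) = |area w z| / ‖w‖ := by
  have hw0 : 0 < ‖w‖ := norm_pos_iff.2 hw
  -- Pythagoras: the squared area is the part normal to `w`, and the last square, the tangential
  -- part, vanishes at the foot of the perpendicular.
  have key (t : ℝ) : dist (toPlane z) (t • w) ^ 2 * ‖w‖ ^ 2 =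
      area w z ^ 2 + (z.1 * w 0 + z.2 * w 1 - t * ‖w‖ ^ 2) ^ 2 := by
    rw [dist_eq_norm, norm_sq_plane, norm_sq_plane]
    simp only [toPlane, area, PiLp.sub_apply, PiLp.smul_apply, smul_eq_mul]
    simp
    ring
  apply le_antisymm
  · refine (Metric.infDist_le_dist_of_mem (y := ((z.1 * w 0 + z.2 * w 1) / ‖w‖ ^ 2) • w)
      (Submodule.smul_mem _ _ (Submodule.mem_span_singleton_self w))).trans ?_
    rw [le_div_iff₀ hw0]
    apply le_of_sq_le_sq _ (abs_nonneg _)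
    rw [mul_pow, key, sq_abs, div_mul_cancel₀ _ (by positivity)]
    simp
  · rw [Metric.le_infDist ⟨0, Submodule.zero_mem _⟩]
    intro y hy
    obtain ⟨t, rfl⟩ := Submodule.mem_span_singleton.1 hy
    rw [div_le_iff₀ hw0]
    apply le_of_sq_le_sq _ (by positivity)
    rw [mul_pow, key, sq_abs]
    nlinarith [sq_nonneg (z.1 * w 0 + z.2 * w 1 - t * ‖w‖ ^ 2)]

theorem mem_strip {w : Plane} (hw : w ≠ 0) {r : ℝ} {z : ℤ × ℤ} :
    z ∈ strip w r ↔ |area w z| ≤ r * ‖w‖ := by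
  rw [strip, mem_ofPred_eq, infDist_span hw, div_le_iff₀ (norm_pos_iff.2 hw)]

theorem mem_posHalfPlane {w : Plane} {z : ℤ × ℤ} : z ∈ posHalfPlane w ↔ 0 < area w z := Iff.rfl

theorem exists_lt_area {w : Plane} (hw : w ≠ 0) (c : ℝ) : ∃ u : ℤ × ℤ, c < area w u := by
  have : ∃ u : ℤ × ℤ, 0 < area w u := by
    by_contra! h
    have h1 := h (1, 0)
    have h2 := h (-1, 0)
    have h3 := h (0, 1)
    have h4 := h (0, -1)
    simp [area] at h1 h2 h3 h4
    apply hw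
    ext i
    fin_cases i <;> simp <;> linarith
  obtain ⟨u, hu⟩ := this
  obtain ⟨n, hn⟩ := exists_nat_gt (c / area w u)
  exact ⟨n • u, by rw [area_nsmul]; rwa [div_lt_iff₀ hu] at hn⟩

/-! ### Finite certificates of expansiveness -/

section Expansive

variable {A : Type*} [TopologicalSpace A] {Y : Subshift A (ℤ × ℤ)}

/-- If finitely many points on one side of the origin code the origin, then wide enough bands
code half planes. -/
theorem codes_band {w : Plane} {F : Finset (ℤ × ℤ)}
    (hF : ∀ f ∈ F, area w f < 0) (hc : Codes Y F {0}) :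
    ∃ B : ℝ, 0 < B ∧ ∀ a b, B ≤ b - a →
      Codes Y {z | a ≤ area w z ∧ area w z ≤ b} {z | a ≤ area w z} := by
  obtain ⟨δ, hδ, hδF⟩ : ∃ δ : ℝ, 0 < δ ∧ ∀ f ∈ F, area w f ≤ -δ := by
    have : ∀ᶠ δ : ℝ in 𝓝[>] 0, ∀ f ∈ F, area w f ≤ -δ := by
      rw [Filter.eventually_all_finset]
      intro f hf
      have := hF f hf
      filter_upwards [Ioo_mem_nhdsGT (show (0 : ℝ) < -area w f by linarith)] with δ hδ
      linarith [hδ.2]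
    obtain ⟨δ, h1, h2⟩ := (this.and self_mem_nhdsWithin).exists
    exact ⟨δ, h2, h1⟩
  obtain ⟨B, hB⟩ : ∃ B : ℝ, ∀ f ∈ F, -B ≤ area w f := by
    obtain ⟨B, hB⟩ := (F.finite_toSet.image fun f => -area w f).bddAbove
    exact ⟨B, fun f hf => by linarith [hB (mem_image_of_mem (fun f => -area w f) hf)]⟩
  refine ⟨max B 1, by positivity, fun a b hab => codes_iff.2 fun x y hxy => ?_⟩
  -- The translate of `F` to a point above level `b` lies at least `δ` lower, but at most `B` lower
  -- and hence still above `a`, so the known region grows by `δ` at each step.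
  have step (n : ℕ) : ∀ z : ℤ × ℤ, a ≤ area w z → area w z ≤ b + n * δ →
      (x : ℤ × ℤ → A) z = (y : ℤ × ℤ → A) z := by
    induction n with
    | zero => intro z h1 h2; exact hxy ⟨h1, by simpa using h2⟩
    | succ n ih =>
      intro z h1 h2
      by_cases h3 : area w z ≤ b
      · exact hxy ⟨h1, h3⟩
      have := hc.point x y z fun f hf => ih _ ?_ ?_
      · simpa using this
      · rw [area_add]; linarith [hB f hf, le_max_left B 1]
      · rw [area_add]; push_cast at h2; linarith [hδF f hf]
  intro z hz
  obtain ⟨n, hn⟩ := exists_nat_gt ((area w z - b) / δ)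
  rw [div_lt_iff₀ hδ] at hn
  exact step n z hz (by linarith)

theorem codes_univ_of_finset {w : Plane} {F : Finset (ℤ × ℤ)}
    (hF : ∀ f ∈ F, area w f < 0) (hc : Codes Y F {0}) (c : ℝ) :
    Codes Y {z | area w z ≤ c} univ := by
  obtain ⟨B, hB0, hB⟩ := codes_band hF hc
  refine codes_iff.2 fun x y hxy z _ => ?_
  rcases le_total (area w z) c with h | h
  · exact hxy h
  · exact codes_iff.1 (hB (c - B) c (by linarith)) x y (hxy.mono fun z hz => hz.2)
      (show c - B ≤ area w z by linarith)

theorem isExpansiveRay_of_finset {w : Plane} (hw : w ≠ 0) {F : Finset (ℤ × ℤ)}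
    (hF : ∀ f ∈ F, area w f < 0) (hc : Codes Y F {0}) : IsExpansiveRay Y w := by
  obtain ⟨B, hB0, hB⟩ := codes_band hF hc
  have hw0 : 0 < ‖w‖ := norm_pos_iff.2 hw
  refine ⟨B / ‖w‖, by positivity, (hB (-B) B (by linarith)).mono ?_ ?_⟩
  · intro z hz
    rw [mem_strip hw, div_mul_cancel₀ _ hw0.ne', abs_le]
    exact hz
  · intro z hz
    rw [mem_posHalfPlane] at hz
    exact show -B ≤ area w z by linarith

variable [Finite A] [DiscreteTopology A]

/-- Compactness leaves finitely many coding points; translating `p` to the origin puts them strictly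
on the negative side, because `area w p` exceeds `c`. -/
theorem exists_finset_of_codes {w : Plane} {c : ℝ} {p : ℤ × ℤ} (hp : c < area w p)
    (h : Codes Y {z | area w z ≤ c} {p}) :
    ∃ F : Finset (ℤ × ℤ), (∀ f ∈ F, area w f < 0) ∧ Codes Y F {0} := by
  classical
  obtain ⟨F, hF, hF'⟩ := h.exists_finset
  refine ⟨F.image fun f => f - p, ?_, codes_iff.2 fun x y hxy => ?_⟩
  · simp only [Finset.mem_image, forall_exists_index, and_imp, forall_apply_eq_imp_iff₂]
    intro f hf
    have : area w f ≤ c := hF hf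
    rw [area_sub]; linarith
  · rintro _ rfl
    have := hF'.point x y (-p) fun f hf =>
      hxy (by rw [neg_add_eq_sub]; exact Finset.mem_coe.2 (Finset.mem_image_of_mem _ hf))
    simpa using this

theorem IsExpansiveRay.exists_finset {w : Plane} (hw : w ≠ 0) (h : IsExpansiveRay Y w) :
    ∃ F : Finset (ℤ × ℤ), (∀ f ∈ F, area w f < 0) ∧ Codes Y F {0} := by
  obtain ⟨r, hr, h⟩ := h
  obtain ⟨p, hp⟩ := exists_lt_area hw (r * ‖w‖)
  refine exists_finset_of_codes hp (h.mono ?_ ?_)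
  · intro z hz
    rw [mem_strip hw] at hz
    exact (abs_le.1 hz).2
  · rintro _ rfl
    rw [mem_posHalfPlane]
    exact lt_of_le_of_lt (by positivity) hp

theorem isExpansiveRay_of_codes {w : Plane} (hw : w ≠ 0) {c : ℝ} {p : ℤ × ℤ} (hp : c < area w p)
    (h : Codes Y {z | area w z ≤ c} {p}) : IsExpansiveRay Y w := by
  obtain ⟨F, hF, hF'⟩ := exists_finset_of_codes hp h
  exact isExpansiveRay_of_finset hw hF hF'

/-- By pigeonhole two distinct multiples of a vector `u` transverse to `w` translate `Y` in the same
way, so the symbol at the origin is repeated at a point of negative area. -/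
theorem isExpansiveRay_of_finite (hY : Y.carrier.Finite) {w : Plane} (hw : w ≠ 0) :
    IsExpansiveRay Y w := by
  have : Finite Y.carrier := hY
  obtain ⟨u, hu⟩ := exists_lt_area hw 0
  obtain ⟨k, l, hkl, h⟩ : ∃ k l : ℕ, k < l ∧ translate Y (k • u) = translate Y (l • u) := by
    obtain ⟨k, l, hne, h⟩ :=
      Finite.exists_ne_map_eq_of_infinite fun k : ℕ => translate Y (k • u)
    rcases lt_or_gt_of_ne hne with h' | h'
    · exact ⟨k, l, h', h⟩
    · exact ⟨l, k, h', h.symm⟩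
  have hper (x : Y.carrier) : (x : ℤ × ℤ → A) 0 = (x : ℤ × ℤ → A) (k • u - l • u) := by
    have := congrFun (congrArg Subtype.val (congrFun h x)) (-(l • u))
    simp only [translate_apply] at this
    rw [add_neg_cancel, ← sub_eq_add_neg] at this
    exact this.symm
  have hneg : area w (k • u - l • u) < 0 := by
    rw [area_sub, area_nsmul, area_nsmul]
    have : (k : ℝ) < l := by exact_mod_cast hkl
    nlinarith
  refine isExpansiveRay_of_codes hw (c := area w (k • u - l • u)) (p := 0) (by simpa using hneg)
    (codes_iff.2 fun x y hxy => ?_)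
  rintro _ rfl
  rw [hper x, hper y]
  exact hxy (mem_ofPred_eq ▸ le_rfl)

end Expansive

/-! ### Changing the basis -/

theorem area_planeMap (M : Matrix (Fin 2) (Fin 2) ℤ) (w : Plane) (z : ℤ × ℤ) :
    area (planeMap M w) (latticeMap M z) = M.det * area w z := by
  rw [Matrix.det_fin_two]
  simp only [area, planeMap, latticeMap]
  simp
  ring

theorem latticeMap_mul (M N : Matrix (Fin 2) (Fin 2) ℤ) (u : ℤ × ℤ) :
    latticeMap (M * N) u = latticeMap M (latticeMap N u) := by
  ext <;> simp [latticeMap, Matrix.mul_apply, Fin.sum_univ_two] <;> ring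

theorem latticeMap_one (u : ℤ × ℤ) : latticeMap 1 u = u := by
  ext <;> simp [latticeMap]

theorem planeMap_mul (M N : Matrix (Fin 2) (Fin 2) ℤ) (p : Plane) :
    planeMap (M * N) p = planeMap M (planeMap N p) := by
  ext i
  fin_cases i <;> simp [planeMap, Matrix.mul_apply, Fin.sum_univ_two] <;> ring

theorem planeMap_one (p : Plane) : planeMap 1 p = p := by
  ext i
  fin_cases i <;> simp [planeMap]

theorem planeMap_smul (M : Matrix (Fin 2) (Fin 2) ℤ) (t : ℝ) (p : Plane) :
    planeMap M (t • p) = t • planeMap M p := by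
  ext i
  fin_cases i <;> simp [planeMap] <;> ring

theorem continuous_planeMap (M : Matrix (Fin 2) (Fin 2) ℤ) : Continuous (planeMap M) := by
  unfold planeMap
  fun_prop

theorem planeMap_inv_cancel (M : GL (Fin 2) ℤ) (p : Plane) :
    planeMap (M⁻¹ : GL (Fin 2) ℤ) (planeMap M p) = p := by
  rw [← planeMap_mul, Units.inv_mul, planeMap_one]

theorem planeMap_cancel_inv (M : GL (Fin 2) ℤ) (p : Plane) :
    planeMap M (planeMap (M⁻¹ : GL (Fin 2) ℤ) p) = p := by
  rw [← planeMap_mul, Units.mul_inv, planeMap_one]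

theorem planeMap_zero (M : Matrix (Fin 2) (Fin 2) ℤ) : planeMap M 0 = 0 := by
  ext i
  fin_cases i <;> simp [planeMap]

theorem planeMap_ne_zero (M : GL (Fin 2) ℤ) {p : Plane} (hp : p ≠ 0) : planeMap M p ≠ 0 := by
  intro h
  apply hp
  rw [← planeMap_inv_cancel M p, h, planeMap_zero]

section Iso

variable {A B : Type*} [TopologicalSpace A] [TopologicalSpace B]
  {Y : Subshift A (ℤ × ℤ)} {Z : Subshift B (ℤ × ℤ)}

/-- The inverse of an isomorphism of `ℤ²`-systems. -/
noncomputable def Z2Iso.symm (Ψ : Z2Iso Y Z) : Z2Iso Z Y where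
  toHomeomorph := Ψ.toHomeomorph.symm
  basisChange := Ψ.basisChange⁻¹
  map_translate u z := by
    apply Ψ.toHomeomorph.injective
    rw [Ψ.map_translate, Homeomorph.apply_symm_apply, Homeomorph.apply_symm_apply,
      ← latticeMap_mul, Units.mul_inv, latticeMap_one]

theorem Z2Iso.OrientationPreserving.symm {Ψ : Z2Iso Y Z} (h : Ψ.OrientationPreserving) :
    Ψ.symm.OrientationPreserving := by
  have h1 : ((Ψ.basisChange⁻¹ : GL (Fin 2) ℤ) : Matrix (Fin 2) (Fin 2) ℤ).det *
      (Ψ.basisChange : Matrix (Fin 2) (Fin 2) ℤ).det = 1 := by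
    rw [← Matrix.det_mul, Units.inv_mul, Matrix.det_one]
  rw [h, mul_one] at h1
  exact h1

variable [Finite A] [Finite B] [DiscreteTopology A] [DiscreteTopology B]

/-- The inverse of `Ψ` is a block code with a finite window, and determinant one preserves `area`.
Agreement on a half plane in `Z` therefore gives agreement on a slightly smaller one in `Y`, which
forces equality. -/
theorem Z2Iso.isExpansiveRay {Ψ : Z2Iso Y Z} (h : Ψ.OrientationPreserving) {w : Plane}
    (hw : w ≠ 0) (he : IsExpansiveRay Y w) : IsExpansiveRay Z (planeMap Ψ.basisChange w) := by
  obtain ⟨F, hF, hc⟩ := he.exists_finset hw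
  obtain ⟨G, -, hG⟩ := exists_finset_determining (S := Z.carrier)
    (u := fun z => (z : ℤ × ℤ → B)) (v := fun z => (Ψ.toHomeomorph.symm z : ℤ × ℤ → A) 0)
    continuous_subtype_val (((continuous_apply 0).comp continuous_subtype_val).comp
      Ψ.toHomeomorph.symm.continuous) (P := univ) (fun x y hxy => by
      have : x = y := Subtype.ext (funext fun i => hxy (mem_univ i))
      rw [this])
  obtain ⟨K, hK⟩ := (G.finite_toSet.image fun g => area (planeMap Ψ.basisChange w) g).bddAbove
  refine isExpansiveRay_of_codes (planeMap_ne_zero _ hw) (c := -1) (p := 0) (by simp) ?_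
  refine codes_iff.2 fun x y hxy => ?_
  have hag : ∀ u : ℤ × ℤ, area w u ≤ -1 - K →
      (Ψ.toHomeomorph.symm x : ℤ × ℤ → A) u = (Ψ.toHomeomorph.symm y : ℤ × ℤ → A) u := by
    intro u hu
    have tr (z : Z.carrier) : (Ψ.toHomeomorph.symm z : ℤ × ℤ → A) u =
        (Ψ.toHomeomorph.symm (translate Z (latticeMap Ψ.basisChange u) z) : ℤ × ℤ → A) 0 := by
      have : Ψ.toHomeomorph.symm (translate Z (latticeMap Ψ.basisChange u) z) =
          translate Y u (Ψ.toHomeomorph.symm z) := by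
        apply Ψ.toHomeomorph.injective
        rw [Ψ.map_translate, Homeomorph.apply_symm_apply, Homeomorph.apply_symm_apply]
      rw [this, translate_apply, add_zero]
    rw [tr x, tr y]
    refine hG _ _ fun g hg => hxy ?_
    have := hK (mem_image_of_mem _ hg)
    rw [mem_ofPred_eq, area_add, area_planeMap, h]
    push_cast
    linarith
  have heq : Ψ.toHomeomorph.symm x = Ψ.toHomeomorph.symm y := Subtype.ext (funext fun u =>
    codes_iff.1 (codes_univ_of_finset hF hc (-1 - K)) _ _ hag (mem_univ u))
  rw [Ψ.toHomeomorph.symm.injective heq]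
  exact eqOn_refl _ _

theorem Z2Iso.isExpansiveRay_iff {Ψ : Z2Iso Y Z} (h : Ψ.OrientationPreserving) {w : Plane}
    (hw : w ≠ 0) : IsExpansiveRay Z (planeMap Ψ.basisChange w) ↔ IsExpansiveRay Y w := by
  refine ⟨fun he => ?_, Z2Iso.isExpansiveRay h hw⟩
  have := Z2Iso.isExpansiveRay h.symm (planeMap_ne_zero _ hw) he
  rwa [Z2Iso.symm, planeMap_inv_cancel] at this

end Iso

/-! ### The spacetime of the rows -/

theorem EqOn_rows_of_row_eq {A : Type*} [TopologicalSpace A] {X : Subshift A ℤ} {φ : Endo X}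
    {z z' : ℤ × ℤ → A} (hz : z ∈ spacetimeSet φ) (hz' : z' ∈ spacetimeSet φ) {j : ℤ}
    (h : row z j = row z' j) (n : ℕ) : row z (j + n) = row z' (j + n) := by
  induction n with
  | zero => simpa using h
  | succ n ih =>
    obtain ⟨x, hx, hx'⟩ := hz (j + n)
    obtain ⟨y, hy, hy'⟩ := hz' (j + n)
    have : x = y := Subtype.ext (by rw [← hx, ← hy, ih])
    push_cast
    rw [← add_assoc, hx', hy', this]

section Recoding

variable {A : Type*} {k R : ℕ} (e : (Fin (R + 1) → A) ≃ Fin k) (ν : ℤ × ℤ ≃+ ℤ × ℤ)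

/-- The recoding of a coloring in the basis `ν` by vertical blocks of height `R + 1`. -/
def blockCode (y : ℤ × ℤ → A) (v : ℤ × ℤ) : Fin k := e fun t => y (ν (v + (0, (t : ℤ))))

theorem blockCode_eq_iff {y y' : ℤ × ℤ → A} {v : ℤ × ℤ} :
    blockCode e ν y v = blockCode e ν y' v ↔
      ∀ t : Fin (R + 1), y (ν (v + (0, (t : ℤ)))) = y' (ν (v + (0, (t : ℤ)))) := by
  rw [blockCode, blockCode, e.apply_eq_iff_eq, funext_iff]

variable [TopologicalSpace A] (Y : Subshift A (ℤ × ℤ))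

variable {Y} in
theorem blockCode_translate (u : ℤ × ℤ) (y : Y.carrier) (v : ℤ × ℤ) :
    blockCode e ν (translate Y u y) v = blockCode e ν y (ν.symm u + v) := by
  simp [blockCode, add_assoc]

variable [DiscreteTopology A]

theorem continuous_blockCode : Continuous (blockCode e ν) := by
  refine continuous_pi fun v => continuous_of_discreteTopology.comp (f := fun y : ℤ × ℤ → A =>
    fun t : Fin (R + 1) => y (ν (v + (0, (t : ℤ))))) ?_
  fun_prop

variable [Finite A]

/-- The subshift of the rows of the recoded colorings. -/
def rowShift : Subshift (Fin k) ℤ where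
  carrier := range fun y : Y.carrier => row (blockCode e ν y) 0
  isClosed := by
    have : Continuous fun y : Y.carrier => row (blockCode e ν (y : ℤ × ℤ → A)) 0 :=
      continuous_pi fun i => (continuous_apply (i, (0 : ℤ))).comp
        ((continuous_blockCode e ν).comp continuous_subtype_val)
    exact (isCompact_range this).isClosed
  mapsTo := by
    rintro i _ ⟨y, rfl⟩
    refine ⟨translate Y (ν (i, 0)) y, ?_⟩
    funext l
    simp only [row]
    rw [blockCode_translate]
    simp [row]

/-- The projection to the zeroth row. -/
def rowProj (y : Y.carrier) : (rowShift e ν Y).carrier := ⟨row (blockCode e ν y) 0, y, rfl⟩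

theorem rowProj_surjective : Function.Surjective (rowProj e ν Y) := by
  rintro ⟨_, y, rfl⟩
  exact ⟨y, rfl⟩

theorem continuous_rowProj : Continuous (rowProj e ν Y) :=
  Continuous.subtype_mk (continuous_pi fun i => (continuous_apply (i, (0 : ℤ))).comp
    ((continuous_blockCode e ν).comp continuous_subtype_val)) _

/-- In the basis `ν`, the band of height `R + 1` codes the upper half plane. -/
def BandCodes (R : ℕ) (ν : ℤ × ℤ ≃+ ℤ × ℤ) (Y : Subshift A (ℤ × ℤ)) : Prop :=
  ∀ x y : Y.carrier, (∀ i j : ℤ, 0 ≤ j → j ≤ R → (x : ℤ × ℤ → A) (ν (i, j)) =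
    (y : ℤ × ℤ → A) (ν (i, j))) → ∀ i j : ℤ, 0 ≤ j → (x : ℤ × ℤ → A) (ν (i, j)) =
    (y : ℤ × ℤ → A) (ν (i, j))

variable {e ν Y}

theorem rowProj_eq {y y' : Y.carrier} (h : rowProj e ν Y y = rowProj e ν Y y') {i j : ℤ}
    (h0 : 0 ≤ j) (hj : j ≤ R) :
    (y : ℤ × ℤ → A) (ν (i, j)) = (y' : ℤ × ℤ → A) (ν (i, j)) := by
  have h1 := congrFun (congrArg Subtype.val h) i
  have h2 := (blockCode_eq_iff e ν).1 h1 ⟨j.toNat, by omega⟩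
  simpa [h0] using h2

/-- A recoded row records a full band, which codes everything above it and in particular the next
recoded row. This makes the row endomorphism well defined. -/
theorem rowProj_translate_eq (H : BandCodes R ν Y) {y y' : Y.carrier}
    (h : rowProj e ν Y y = rowProj e ν Y y') :
    rowProj e ν Y (translate Y (ν (0, 1)) y) = rowProj e ν Y (translate Y (ν (0, 1)) y') := by
  have h1 := H y y' fun i j h0 hj => rowProj_eq h h0 hj
  apply Subtype.ext
  funext i
  refine (blockCode_eq_iff e ν).2 fun t => ?_
  rw [translate_apply, translate_apply, ← map_add]
  exact h1 _ _ (by simp; positivity)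

/-- The endomorphism of the row shift given by the vertical translation. -/
noncomputable def rowEndoFun (x : (rowShift e ν Y).carrier) : (rowShift e ν Y).carrier :=
  rowProj e ν Y (translate Y (ν (0, 1)) (rowProj_surjective e ν Y x).choose)

theorem rowEndoFun_rowProj (H : BandCodes R ν Y) (y : Y.carrier) :
    rowEndoFun (rowProj e ν Y y) = rowProj e ν Y (translate Y (ν (0, 1)) y) :=
  rowProj_translate_eq H (rowProj_surjective e ν Y _).choose_spec

variable (e) in
/-- The endomorphism of the row shift given by the vertical translation. -/
noncomputable def rowEndo (H : BandCodes R ν Y) : Endo (rowShift e ν Y) where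
  toFun := rowEndoFun
  continuous := by
    have hq : IsQuotientMap (rowProj e ν Y) :=
      (continuous_rowProj e ν Y).isClosedMap.isQuotientMap (continuous_rowProj e ν Y)
        (rowProj_surjective e ν Y)
    rw [hq.continuous_iff]
    have : rowEndoFun ∘ rowProj e ν Y = fun y => rowProj e ν Y (translate Y (ν (0, 1)) y) :=
      funext fun y => rowEndoFun_rowProj H y
    rw [this]
    exact (continuous_rowProj e ν Y).comp (continuous_translate Y _)
  surjective := by
    intro x
    obtain ⟨y, rfl⟩ := rowProj_surjective e ν Y x
    refine ⟨rowProj e ν Y (translate Y (-ν (0, 1)) y), ?_⟩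
    rw [rowEndoFun_rowProj H, translate_translate, neg_add_cancel, translate_zero]
  commutes := by
    intro x
    obtain ⟨y, rfl⟩ := rowProj_surjective e ν Y x
    have h1 (y : Y.carrier) : translate (rowShift e ν Y) 1 (rowProj e ν Y y) =
        rowProj e ν Y (translate Y (ν (1, 0)) y) := by
      apply Subtype.ext
      funext i
      simp only [translate_apply, rowProj, row]
      rw [blockCode_translate]
      simp
    rw [h1, rowEndoFun_rowProj H, rowEndoFun_rowProj H, h1, translate_translate,
      translate_translate, add_comm]

theorem row_blockCode (y : Y.carrier) (j : ℤ) :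
    row (blockCode e ν y) j = rowProj e ν Y (translate Y (ν (0, j)) y) := by
  funext i
  simp only [rowProj, row]
  rw [blockCode_translate]
  simp

theorem blockCode_mem (H : BandCodes R ν Y) (y : Y.carrier) :
    blockCode e ν y ∈ (spacetime (rowEndo e H)).carrier := by
  intro j
  refine ⟨rowProj e ν Y (translate Y (ν (0, j)) y), row_blockCode y j, ?_⟩
  rw [row_blockCode]
  change _ = (rowEndoFun (rowProj e ν Y _) : (rowShift e ν Y).carrier).1
  rw [rowEndoFun_rowProj H, translate_translate, ← map_add]
  simp

theorem exists_blockCode_eq (H : BandCodes R ν Y) {z : ℤ × ℤ → Fin k}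
    (hz : z ∈ (spacetime (rowEndo e H)).carrier) : ∃ y : Y.carrier, blockCode e ν y = z := by
  -- A preimage of row `-n` reproduces every row above it, because rows evolve deterministically
  -- upwards; compactness then gives a common point of these nested closed sets.
  let S (n : ℕ) : Set Y.carrier := {y | ∀ i j : ℤ, -(n : ℤ) ≤ j → blockCode e ν y (i, j) = z (i, j)}
  have hne (n : ℕ) : (S n).Nonempty := by
    obtain ⟨x, hx, -⟩ := hz (-(n : ℤ))
    obtain ⟨y, rfl⟩ := rowProj_surjective e ν Y x
    refine ⟨translate Y (ν (0, n)) y, fun i j hj => ?_⟩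
    have h0 : row (blockCode e ν (translate Y (ν (0, n)) y)) (-n) = row z (-n) := by
      rw [hx, row_blockCode, translate_translate, ← map_add]
      rw [show ((0, (n : ℤ)) + (0, -(n : ℤ)) : ℤ × ℤ) = 0 by simp, map_zero, translate_zero]
    have h1 := EqOn_rows_of_row_eq (blockCode_mem H _) hz h0 (j + n).toNat
    have h2 : -(n : ℤ) + ((j + n).toNat : ℤ) = j := by omega
    rw [h2] at h1
    exact congrFun h1 i
  have hcl (n : ℕ) : IsClosed (S n) := by
    simp only [S, ofPred_forall]
    refine isClosed_iInter fun i => isClosed_iInter fun j => isClosed_iInter fun _ =>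
      isClosed_eq ?_ continuous_const
    exact (continuous_apply (i, j)).comp ((continuous_blockCode e ν).comp continuous_subtype_val)
  obtain ⟨y, hy⟩ := IsCompact.nonempty_iInter_of_sequence_nonempty_isCompact_isClosed S
    (fun n y hy i j hj => hy i j (by push_cast; omega)) hne (hcl 0).isCompact hcl
  refine ⟨y, funext fun ⟨i, j⟩ => ?_⟩
  exact mem_iInter.1 hy j.natAbs i j (by omega)

variable (e) in
/-- The homeomorphism of a subshift with the spacetime of its row shift. -/
noncomputable def spacetimeHomeomorph (H : BandCodes R ν Y) :
    Y.carrier ≃ₜ (spacetime (rowEndo e H)).carrier :=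
  Continuous.homeoOfEquivCompactToT2 (f := Equiv.ofBijective
    (fun y : Y.carrier => (⟨blockCode e ν y, blockCode_mem H y⟩ :
      (spacetime (rowEndo e H)).carrier)) (by
    constructor
    · intro y y' h
      apply Subtype.ext
      funext v
      have := (blockCode_eq_iff e ν).1 (congrFun (congrArg Subtype.val h) (ν.symm v)) 0
      simpa [show ν (0, 0) = 0 from map_zero ν] using this
    · rintro ⟨z, hz⟩
      obtain ⟨y, hy⟩ := exists_blockCode_eq H hz
      exact ⟨y, Subtype.ext hy⟩))
    (Continuous.subtype_mk ((continuous_blockCode e ν).comp continuous_subtype_val) _)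

variable (e) in
/-- The isomorphism of a subshift with the spacetime of its row shift. -/
noncomputable def spacetimeIso (H : BandCodes R ν Y) (M : GL (Fin 2) ℤ)
    (hM : ∀ u, latticeMap M u = ν.symm u) : Z2Iso Y (spacetime (rowEndo e H)) where
  toHomeomorph := spacetimeHomeomorph e H
  basisChange := M
  map_translate u y := by
    apply Subtype.ext
    funext v
    rw [translate_apply, hM]
    exact blockCode_translate e ν u y v

/-- A subshift with an expansive rational ray is isomorphic to a spacetime, the ray corresponding
to the horizontal direction. -/
theorem exists_spacetimeIso {m n a b : ℤ} (hab : a * m + b * n = 1)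
    (h : IsExpansiveRay Y (toPlane (m, n))) :
    ∃ (k : ℕ) (X : Subshift (Fin k) ℤ) (φ : Endo X) (Ψ : Z2Iso Y (spacetime φ)),
      Ψ.OrientationPreserving ∧ planeMap Ψ.basisChange (toPlane (m, n)) = !₂[1, 0] := by
  have hw : toPlane (m, n) ≠ 0 := by
    intro h0
    have h1 := congrArg (fun p : Plane => p 0) h0
    have h2 := congrArg (fun p : Plane => p 1) h0
    simp [toPlane] at h1 h2
    simp [h1, h2] at hab
  obtain ⟨F, hF, hc⟩ := h.exists_finset hw
  obtain ⟨B, -, hB⟩ := codes_band hF hc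
  -- The Bézout coefficients complete `(m, n)` to the positively oriented basis `(m, n)`, `(-b, a)`,
  -- in which `area` is the second coordinate.
  let ν : ℤ × ℤ ≃+ ℤ × ℤ :=
    { toFun := fun v => (m * v.1 - b * v.2, n * v.1 + a * v.2)
      invFun := fun v => (a * v.1 + b * v.2, -n * v.1 + m * v.2)
      left_inv := fun v => by
        ext
        · linear_combination v.1 * hab
        · linear_combination v.2 * hab
      right_inv := fun v => by
        ext
        · linear_combination v.1 * hab
        · linear_combination v.2 * hab
      map_add' := fun u v => by ext <;> simp <;> ring }
  have hν (v : ℤ × ℤ) : area (toPlane (m, n)) (ν v) = v.2 := by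
    have : m * (n * v.1 + a * v.2) - n * (m * v.1 - b * v.2) = v.2 := by
      linear_combination v.2 * hab
    rw [← this]
    simp [area, toPlane, ν]
  have H : BandCodes ⌈B⌉₊ ν Y := by
    intro x y hxy i j hj
    have := codes_iff.1 (hB 0 ⌈B⌉₊ (by simpa using Nat.le_ceil B)) x y (fun z hz => ?_)
    · refine this ?_
      rw [mem_ofPred_eq, hν]
      exact_mod_cast hj
    · obtain ⟨⟨i, j⟩, rfl⟩ := ν.surjective z
      rw [mem_ofPred_eq, hν] at hz
      exact hxy i j (by exact_mod_cast hz.1) (by exact_mod_cast hz.2)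
  let M : GL (Fin 2) ℤ :=
    ⟨!![a, b; -n, m], !![m, -b; n, a], by
      ext i j; fin_cases i <;> fin_cases j <;> simp <;> linarith, by
      ext i j; fin_cases i <;> fin_cases j <;> simp <;> linarith⟩
  refine ⟨_, _, _, spacetimeIso (Finite.equivFin (Fin (⌈B⌉₊ + 1) → A)) H M fun u => rfl, ?_, ?_⟩
  · change (!![a, b; -n, m] : Matrix (Fin 2) (Fin 2) ℤ).det = 1
    rw [Matrix.det_fin_two_of]
    linarith
  · change planeMap !![a, b; -n, m] _ = _
    have : (a : ℝ) * m + b * n = 1 := by exact_mod_cast hab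
    ext i
    fin_cases i <;> simp [planeMap, toPlane] <;> linarith

end Recoding

/-- A surjection of a finite set is injective, so row `0` determines the rows below it as well as
those above. -/
theorem spacetime_finite {A : Type*} [TopologicalSpace A] [DiscreteTopology A] [Finite A]
    {X : Subshift A ℤ} (φ : Endo X) (hX : X.carrier.Finite) :
    (spacetime φ).carrier.Finite := by
  have hX' : Finite X.carrier := hX
  have hinj : Function.Injective φ.toFun := Finite.injective_iff_surjective.2 φ.surjective
  refine Set.Finite.of_finite_image (f := fun z => row z 0) (hX.subset ?_) ?_
  · rintro _ ⟨z, hz, rfl⟩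
    obtain ⟨x, hx, -⟩ := hz 0
    change row z 0 ∈ _
    rw [hx]
    exact x.2
  · intro z hz z' hz' h
    have hneg (n : ℕ) : row z (-n) = row z' (-n) := by
      induction n with
      | zero => simpa using h
      | succ n ih =>
        obtain ⟨x, hx, hx'⟩ := hz (-(n + 1 : ℕ))
        obtain ⟨y, hy, hy'⟩ := hz' (-(n + 1 : ℕ))
        rw [hx, hy]
        have e1 : (-((n + 1 : ℕ) : ℤ) + 1) = -n := by push_cast; ring
        rw [e1] at hx' hy'
        rw [hinj (Subtype.ext (hx'.symm.trans (ih.trans hy')))]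
    funext ⟨i, j⟩
    have h1 := EqOn_rows_of_row_eq hz hz' (hneg j.natAbs) (j + j.natAbs).toNat
    have h2 : -(j.natAbs : ℤ) + ((j + j.natAbs).toNat : ℤ) = j := by omega
    rw [h2] at h1
    exact congrFun h1 i

/-! ### One-dimensional coding -/

section Coding

variable {A : Type*} [TopologicalSpace A] {X : Subshift A ℤ}

theorem MapCodes.mono {f : X.carrier → X.carrier} {P P' Q Q' : Set ℤ} (h : MapCodes f P Q)
    (hP : P ⊆ P') (hQ : Q' ⊆ Q) : MapCodes f P' Q' :=
  fun x y hxy => (h x y (hxy.mono hP)).mono hQ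

theorem MapCodes.comp {f g : X.carrier → X.carrier} {P Q R : Set ℤ} (hg : MapCodes g Q R)
    (hf : MapCodes f P Q) : MapCodes (g ∘ f) P R :=
  fun x y hxy => hg _ _ (hf x y hxy)

theorem MapCodes.translate {f : X.carrier → X.carrier}
    (hf : ∀ u x, f (translate X u x) = translate X u (f x)) {P Q : Set ℤ} (h : MapCodes f P Q)
    (u : ℤ) {P' Q' : Set ℤ} (hP : ∀ i ∈ P, u + i ∈ P') (hQ : ∀ i ∈ Q', i - u ∈ Q) :
    MapCodes f P' Q' := by
  intro x y hxy i hi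
  have := h (LightCone.translate X u x) (LightCone.translate X u y) (fun j hj => hxy (hP j hj))
    (hQ i hi)
  rw [hf, hf] at this
  simpa using this

theorem MapCodes.exists_finset [Finite A] [DiscreteTopology A] {f : X.carrier → X.carrier}
    (hf : Continuous f) {P : Set ℤ} {m : ℤ} (h : MapCodes f P {m}) :
    ∃ F : Finset ℤ, ↑F ⊆ P ∧ MapCodes f F {m} := by
  obtain ⟨F, hF, hF'⟩ := exists_finset_determining (S := X.carrier)
    (u := fun x => (x : ℤ → A)) (v := fun x => (f x : ℤ → A) m) continuous_subtype_val
    ((continuous_apply m).comp (continuous_subtype_val.comp hf)) (P := P)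
    (fun x y hxy => h x y hxy rfl)
  refine ⟨F, hF, fun x y hxy => ?_⟩
  rintro _ rfl
  exact hF' x y hxy

theorem Endo.iterate_translate (φ : Endo X) (n : ℕ) (u : ℤ) (x : X.carrier) :
    φ.toFun^[n] (LightCone.translate X u x) = LightCone.translate X u (φ.toFun^[n] x) :=
  ((Function.Commute.iterate_left (f := φ.toFun) (g := LightCone.translate X u)
    (fun x => φ.commutes_translate u x) n) x)

/-- If two families of statistics on a finite alphabet have equally many values, and one is a
function of the other, then they determine each other. -/
theorem determines_of_surjective {S α β : Type*} [Finite α] [Finite β] {p : S → α} {q : S → β}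
    {g : S → S} (hg : Function.Surjective g) (hqp : ∀ x y, q x = q y → p x = p y)
    (hpq : ∀ x y, p x = p y → q (g x) = q (g y)) (x y : S) (h : p x = p y) : q x = q y := by
  let a : range q → range p := fun b => ⟨p b.2.choose, mem_range_self _⟩
  let b : range p → range q := fun c => ⟨q (g c.2.choose), mem_range_self _⟩
  have ha (x : S) : a ⟨q x, mem_range_self x⟩ = ⟨p x, mem_range_self x⟩ :=
    Subtype.ext (hqp _ _ (mem_range_self (f := q) x).choose_spec)
  have hb (x : S) : b ⟨p x, mem_range_self x⟩ = ⟨q (g x), mem_range_self _⟩ :=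
    Subtype.ext (hpq _ _ (mem_range_self (f := p) x).choose_spec)
  have hbs : Function.Surjective b := by
    rintro ⟨_, x, rfl⟩
    obtain ⟨x, rfl⟩ := hg x
    exact ⟨_, hb x⟩
  have has : Function.Surjective a := by
    rintro ⟨_, x, rfl⟩
    exact ⟨_, ha x⟩
  have hinj : Function.Injective (b ∘ a) :=
    Finite.injective_iff_surjective.2 (hbs.comp has)
  have := hinj.of_comp (a₁ := ⟨q x, mem_range_self x⟩) (a₂ := ⟨q y, mem_range_self y⟩)
    (by rw [ha, ha]; exact Subtype.ext h)
  exact congrArg Subtype.val this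

/-- Sliding the window one step at a time to either side shows that the word on `[0, N]` determines
the whole sequence. -/
theorem finite_of_codes_neighbours [Finite A] {N : ℤ} (hN : 0 ≤ N)
    (h : MapCodes (id : X.carrier → X.carrier) (Icc 0 N) (Icc (-1) (N + 1))) :
    X.carrier.Finite := by
  have hk (k : ℕ) : MapCodes (id : X.carrier → X.carrier) (Icc 0 N) (Icc (-k) (N + k)) := by
    induction k with
    | zero => intro x y hxy; simpa using hxy
    | succ k ih =>
      intro x y hxy
      have hc := ih x y hxy
      have hr := h.translate (fun _ _ => rfl) k (P' := Icc (-(k : ℤ)) (N + k))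
        (Q' := {N + k + 1}) (fun i hi => by simp only [mem_Icc] at hi ⊢; omega)
        (fun i hi => by simp only [mem_Icc, mem_singleton_iff] at hi ⊢; omega) x y hc
      have hl := h.translate (fun _ _ => rfl) (-k) (P' := Icc (-(k : ℤ)) (N + k))
        (Q' := {-(k : ℤ) - 1}) (fun i hi => by simp only [mem_Icc] at hi ⊢; omega)
        (fun i hi => by simp only [mem_Icc, mem_singleton_iff] at hi ⊢; omega) x y hc
      intro i hi
      simp only [mem_Icc] at hi
      push_cast at hi
      by_cases h3 : i ∈ Icc (-(k : ℤ)) (N + k)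
      · exact hc h3
      simp only [mem_Icc] at h3
      by_cases h4 : i = N + k + 1
      · exact hr h4
      · exact hl (show i = -(k : ℤ) - 1 by omega)
  have : Function.Injective fun x : X.carrier => fun i : Icc (0 : ℤ) N => (x : ℤ → A) i := by
    intro x y hxy
    apply Subtype.ext
    funext i
    refine hk (i.natAbs + N.natAbs) x y (fun j hj => congrFun hxy ⟨j, hj⟩) ?_
    simp only [mem_Icc]
    omega
  exact Finite.of_injective _ this

variable [Finite A] [DiscreteTopology A]

/-- Unless `X` is finite, the half lines cannot code overlapping half lines. -/
theorem le_of_mem_coded (hX : X.carrier.Infinite) (φ : Endo X) {n : ℕ} {m m' : ℤ}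
    (hm : m ∈ rightCoded φ n) (hm' : m' ∈ leftCoded φ n) : m' ≤ m := by
  by_contra! hlt
  apply hX
  have hcont : Continuous φ.toFun^[n] := φ.continuous.iterate n
  have htr := φ.iterate_translate n
  obtain ⟨F, hF, hFc⟩ := (MapCodes.mono hm subset_rfl
    (show {m} ⊆ Ici m by simp)).exists_finset hcont
  obtain ⟨G, hG, hGc⟩ := (MapCodes.mono hm' subset_rfl
    (show {m'} ⊆ Iic m' by simp)).exists_finset hcont
  obtain ⟨K, hK⟩ := F.finite_toSet.bddAbove
  obtain ⟨K', hK'⟩ := G.finite_toSet.bddBelow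
  obtain ⟨K₀, h0, h1, h2⟩ : ∃ K₀ : ℤ, 0 ≤ K₀ ∧ K ≤ K₀ ∧ -K₀ ≤ K' :=
    ⟨max (max K (-K')) 0, by omega, by omega, by omega⟩
  -- With this `N`, `m + N - K₀ = m' + K₀`: up to this position the translated window `F` stays in
  -- `[0, N]`, and beyond it the translate of `G` does.
  set N : ℤ := m' - m + 2 * K₀ with hN
  have hbig : MapCodes φ.toFun^[n] (Icc 0 N) (Icc m (m' + N)) := by
    intro x y hxy i hi
    simp only [mem_Icc] at hi
    by_cases hi' : i ≤ m + N - K₀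
    · refine hFc.translate htr (i - m) (P' := Icc 0 N) (Q' := {i}) (fun j hj => ?_)
        (fun j hj => ?_) x y hxy rfl
      · have hj1 : 0 ≤ j := hF hj
        have hj2 : j ≤ K := hK hj
        simp only [mem_Icc]; omega
      · rw [mem_singleton_iff] at hj ⊢; omega
    · refine hGc.translate htr (i - m') (P' := Icc 0 N) (Q' := {i}) (fun j hj => ?_)
        (fun j hj => ?_) x y hxy rfl
      · have hj1 : j ≤ 0 := hG hj
        have hj2 : K' ≤ j := hK' hj
        simp only [mem_Icc]; omega
      · rw [mem_singleton_iff] at hj ⊢; omega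
  -- Since `m < m'`, words of length `N + 1` determine image words of length `N + 2`. As `φ^n` is
  -- surjective, there are no more words of length `N + 2` than of length `N + 1`, so a word has
  -- only one extension by one letter, on the right (`s = 0`) or on the left (`s = -1`).
  have hext (s : ℤ) (hs : s = 0 ∨ s = -1) :
      MapCodes (id : X.carrier → X.carrier) (Icc 0 N) (Icc s (s + N + 1)) := by
    intro x y hxy i hi
    have hsurj : Function.Surjective fun x : X.carrier =>
        translate X (m - s) (φ.toFun^[n] x) := by
      intro x
      obtain ⟨y, hy⟩ := φ.surjective.iterate n (translate X (-(m - s)) x)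
      exact ⟨y, by
        change translate X (m - s) (φ.toFun^[n] y) = x
        rw [hy, translate_translate, neg_add_cancel, translate_zero]⟩
    have := determines_of_surjective (S := X.carrier) (α := Icc 0 N → A)
      (β := Icc s (s + N + 1) → A) (p := fun x i => (x : ℤ → A) i)
      (q := fun x i => (x : ℤ → A) i) hsurj (fun x y hxy => funext fun i =>
        congrFun hxy ⟨i, by have := i.2; simp only [mem_Icc] at this ⊢; omega⟩)
      (fun x y hxy => funext fun i => hbig x y (fun j hj => congrFun hxy ⟨j, hj⟩) (by
        have := i.2; simp only [mem_Icc] at this ⊢; omega)) x y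
      (funext fun i => hxy i.2)
    exact congrFun this ⟨i, hi⟩
  refine finite_of_codes_neighbours (N := N) (by omega) fun x y hxy i hi => ?_
  simp only [mem_Icc] at hi
  by_cases hi0 : i = -1
  · exact hext (-1) (Or.inr rfl) x y hxy (by simp only [mem_Icc]; omega)
  · exact hext 0 (Or.inl rfl) x y hxy (by simp only [mem_Icc]; omega)

theorem exists_mapCodes_finset (φ : Endo X) (n : ℕ) :
    ∃ F : Finset ℤ, MapCodes φ.toFun^[n] F {0} := by
  obtain ⟨F, -, hF⟩ := MapCodes.exists_finset (P := univ) (m := 0) (φ.continuous.iterate n)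
    (fun x y hxy => by rw [show x = y from Subtype.ext (funext fun i => hxy (mem_univ i))]
                       exact eqOn_refl _ _)
  exact ⟨F, hF⟩

theorem rightCoded_nonempty (φ : Endo X) (n : ℕ) : (rightCoded φ n).Nonempty := by
  obtain ⟨F, hF⟩ := exists_mapCodes_finset φ n
  obtain ⟨K, hK⟩ := F.finite_toSet.bddBelow
  refine ⟨-K, fun x y hxy i hi => hF.translate (φ.iterate_translate n) i (P' := Ici 0)
    (Q' := {i}) (fun j hj => ?_) (fun j hj => ?_) x y hxy rfl⟩
  · have := hK hj
    simp only [mem_Ici] at hi ⊢; omega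
  · rw [mem_singleton_iff] at hj ⊢; omega

theorem leftCoded_nonempty (φ : Endo X) (n : ℕ) : (leftCoded φ n).Nonempty := by
  obtain ⟨F, hF⟩ := exists_mapCodes_finset φ n
  obtain ⟨K, hK⟩ := F.finite_toSet.bddAbove
  refine ⟨-K, fun x y hxy i hi => hF.translate (φ.iterate_translate n) i (P' := Iic 0)
    (Q' := {i}) (fun j hj => ?_) (fun j hj => ?_) x y hxy rfl⟩
  · have := hK hj
    simp only [mem_Iic] at hi ⊢; omega
  · rw [mem_singleton_iff] at hj ⊢; omega

/-! ### Existence of the extrema and Fekete limits -/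

section Infinite

variable (hX : X.carrier.Infinite) (φ : Endo X)
include hX

theorem isLeast_Wplus (n : ℕ) : IsLeast (rightCoded φ n) (Wplus φ n) := by
  obtain ⟨m', hm'⟩ := leftCoded_nonempty φ n
  have hb : BddBelow (rightCoded φ n) := ⟨m', fun m hm => le_of_mem_coded hX φ hm hm'⟩
  exact ⟨Int.csInf_mem (rightCoded_nonempty φ n) hb, fun m hm => csInf_le hb hm⟩

theorem isGreatest_Wminus (n : ℕ) : IsGreatest (leftCoded φ n) (Wminus φ n) := by
  obtain ⟨m, hm⟩ := rightCoded_nonempty φ n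
  have hb : BddAbove (leftCoded φ n) := ⟨m, fun m' hm' => le_of_mem_coded hX φ hm hm'⟩
  exact ⟨Int.csSup_mem (leftCoded_nonempty φ n) hb, fun m hm => le_csSup hb hm⟩

theorem Wminus_le_Wplus (n : ℕ) : Wminus φ n ≤ Wplus φ n :=
  le_of_mem_coded hX φ (isLeast_Wplus hX φ n).1 (isGreatest_Wminus hX φ n).1

theorem Wplus_add_le (n k : ℕ) : Wplus φ (n + k) ≤ Wplus φ n + Wplus φ k := by
  apply (isLeast_Wplus hX φ (n + k)).2
  have hk := (isLeast_Wplus hX φ k).1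
  have hn := (isLeast_Wplus hX φ n).1
  change MapCodes _ _ _
  rw [Function.iterate_add]
  refine MapCodes.comp ?_ hk
  exact MapCodes.translate (φ.iterate_translate n) hn (Wplus φ k)
    (fun i hi => by simp only [mem_Ici] at hi ⊢; omega)
    (fun i hi => by simp only [mem_Ici] at hi ⊢; omega)

theorem le_Wminus_add (n k : ℕ) : Wminus φ n + Wminus φ k ≤ Wminus φ (n + k) := by
  apply (isGreatest_Wminus hX φ (n + k)).2
  have hk := (isGreatest_Wminus hX φ k).1
  have hn := (isGreatest_Wminus hX φ n).1
  change MapCodes _ _ _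
  rw [Function.iterate_add]
  refine MapCodes.comp ?_ hk
  exact MapCodes.translate (φ.iterate_translate n) hn (Wminus φ k)
    (fun i hi => by simp only [mem_Iic] at hi ⊢; omega)
    (fun i hi => by simp only [mem_Iic] at hi ⊢; omega)

theorem subadditive_Wplus : Subadditive fun n => (Wplus φ n : ℝ) := fun n k => by
  have : (Wplus φ (n + k) : ℝ) ≤ Wplus φ n + Wplus φ k := by
    exact_mod_cast Wplus_add_le hX φ n k
  exact this

theorem subadditive_neg_Wminus : Subadditive fun n => -(Wminus φ n : ℝ) := fun n k => by
  have : (Wminus φ n : ℝ) + Wminus φ k ≤ Wminus φ (n + k) := by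
    exact_mod_cast le_Wminus_add hX φ n k
  linarith

theorem nsmul_Wplus_le (n : ℕ) : Wplus φ (n + 1) ≤ (n + 1) * Wplus φ 1 := by
  induction n with
  | zero => simp
  | succ n ih => have := Wplus_add_le hX φ (n + 1) 1; push_cast; linarith

theorem le_nsmul_Wminus (n : ℕ) : (n + 1) * Wminus φ 1 ≤ Wminus φ (n + 1) := by
  induction n with
  | zero => simp
  | succ n ih => have := le_Wminus_add hX φ (n + 1) 1; push_cast; linarith

theorem bddBelow_Wplus : BddBelow (range fun n : ℕ => (Wplus φ n : ℝ) / n) := by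
  -- The `0` accounts for the term `n = 0`, where division by zero returns `0`.
  refine ⟨min 0 (Wminus φ 1), ?_⟩
  rintro _ ⟨n, rfl⟩
  rcases n with _ | n
  · simp
  · refine (min_le_right _ _).trans ?_
    rw [le_div_iff₀ (by positivity)]
    have : (n + 1) * Wminus φ 1 ≤ Wplus φ (n + 1) :=
      (le_nsmul_Wminus hX φ n).trans (Wminus_le_Wplus hX φ _)
    have h2 : ((n : ℝ) + 1) * Wminus φ 1 ≤ Wplus φ (n + 1) := by exact_mod_cast this
    push_cast
    linarith

theorem bddBelow_neg_Wminus : BddBelow (range fun n : ℕ => -(Wminus φ n : ℝ) / n) := by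
  refine ⟨min 0 (-Wplus φ 1), ?_⟩
  rintro _ ⟨n, rfl⟩
  rcases n with _ | n
  · simp
  · refine (min_le_right _ _).trans ?_
    rw [le_div_iff₀ (by positivity)]
    have : Wminus φ (n + 1) ≤ (n + 1) * Wplus φ 1 :=
      (Wminus_le_Wplus hX φ _).trans (nsmul_Wplus_le hX φ n)
    have h2 : (Wminus φ (n + 1) : ℝ) ≤ ((n : ℝ) + 1) * Wplus φ 1 := by exact_mod_cast this
    push_cast
    linarith

theorem alphaPlus_eq : alphaPlus φ = (subadditive_Wplus hX φ).lim :=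
  ((subadditive_Wplus hX φ).tendsto_lim (bddBelow_Wplus hX φ)).limUnder_eq

theorem tendsto_neg_Wminus :
    Tendsto (fun n : ℕ => (Wminus φ n : ℝ) / n) atTop (𝓝 (-(subadditive_neg_Wminus hX φ).lim)) := by
  have := ((subadditive_neg_Wminus hX φ).tendsto_lim (bddBelow_neg_Wminus hX φ)).neg
  refine this.congr fun n => ?_
  ring

theorem alphaMinus_eq : alphaMinus φ = -(subadditive_neg_Wminus hX φ).lim :=
  (tendsto_neg_Wminus hX φ).limUnder_eq

theorem coneWellDefined : ConeWellDefined φ where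
  isLeast := isLeast_Wplus hX φ
  isGreatest := isGreatest_Wminus hX φ
  tendsto_plus := by
    rw [alphaPlus_eq hX φ]
    exact (subadditive_Wplus hX φ).tendsto_lim (bddBelow_Wplus hX φ)
  tendsto_minus := by
    rw [alphaMinus_eq hX φ]
    exact tendsto_neg_Wminus hX φ

theorem Wplus_zero_nonneg : 0 ≤ Wplus φ 0 := by
  have := Wplus_add_le hX φ 0 0
  simp at this
  exact this

theorem Wminus_zero_nonpos : Wminus φ 0 ≤ 0 := by
  have := le_Wminus_add hX φ 0 0
  simp at this
  exact this

/-- The limit of a subadditive sequence is the infimum of its quotients. This is the nonnegativity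
needed for `false_of_escape`. -/
theorem alphaPlus_mul_le (n : ℕ) : alphaPlus φ * n ≤ Wplus φ n := by
  rcases Nat.eq_zero_or_pos n with rfl | hn
  · simpa using Wplus_zero_nonneg hX φ
  · rw [alphaPlus_eq hX φ, ← le_div_iff₀ (by positivity)]
    exact (subadditive_Wplus hX φ).lim_le_div (bddBelow_Wplus hX φ) hn.ne'

theorem le_alphaMinus_mul (n : ℕ) : Wminus φ n ≤ alphaMinus φ * n := by
  rcases Nat.eq_zero_or_pos n with rfl | hn
  · simpa using Wminus_zero_nonpos hX φ
  · have := (subadditive_neg_Wminus hX φ).lim_le_div (bddBelow_neg_Wminus hX φ) hn.ne'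
    rw [le_div_iff₀ (by positivity)] at this
    rw [alphaMinus_eq hX φ]
    linarith

theorem alphaMinus_le_alphaPlus : alphaMinus φ ≤ alphaPlus φ := by
  refine le_of_tendsto_of_tendsto' (coneWellDefined hX φ).tendsto_minus
    (coneWellDefined hX φ).tendsto_plus fun n => ?_
  have : (Wminus φ n : ℝ) ≤ Wplus φ n := by exact_mod_cast Wminus_le_Wplus hX φ n
  gcongr

end Infinite

end Coding
/-! ### Expansive rays of a spacetime -/

/-- A nonnegative sequence of sublinear growth admits no escape at positive speed. -/
theorem false_of_escape {g : ℕ → ℝ} (h0 : ∀ j, 0 ≤ g j)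
    (hlim : Tendsto (fun j : ℕ => g j / j) atTop (𝓝 0)) {N : ℕ} (hN : 0 < N) {ε : ℝ} (hε : 0 < ε)
    (h : ∀ j, N ≤ j → ∃ i : ℕ, j ≤ i + N ∧ g j + ε * |(i : ℝ) - j| + ε ≤ g i) : False := by
  -- A bound `G` on the block of length `N` before `M` improves to `G - ε` everywhere from `M` on.
  -- Iterating over blocks eventually contradicts `0 ≤ g`.
  have claim (M : ℕ) (hM : N ≤ M) (G : ℝ) (hG : ∀ j, M ≤ j + N → j < M → g j ≤ G) (j₀ : ℕ)
      (hj₀ : M ≤ j₀) : g j₀ ≤ G - ε := by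
    by_contra! hcon
    obtain ⟨η, hη, hηε, hηj⟩ : ∃ η : ℝ, 0 < η ∧ η ≤ ε ∧ η * j₀ < g j₀ - (G - ε) := by
      have h1 : 0 < (g j₀ - (G - ε)) / (j₀ + 1) := div_pos (by linarith) (by positivity)
      refine ⟨min ε ((g j₀ - (G - ε)) / (j₀ + 1)), lt_min hε h1, min_le_left _ _, ?_⟩
      calc min ε ((g j₀ - (G - ε)) / (j₀ + 1)) * j₀
          ≤ (g j₀ - (G - ε)) / (j₀ + 1) * j₀ := by gcongr; exact min_le_right _ _
        _ < (g j₀ - (G - ε)) / (j₀ + 1) * (j₀ + 1) := by gcongr; linarith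
        _ = _ := div_mul_cancel₀ _ (by positivity)
    have hfin : {i : ℕ | M ≤ i ∧ g j₀ - η * j₀ ≤ g i - η * i}.Finite := by
      have hev : ∀ᶠ i : ℕ in atTop, g i - η * i < g j₀ - η * j₀ := by
        filter_upwards [hlim.eventually_lt_const (half_pos hη), eventually_gt_atTop 0,
          (tendsto_natCast_atTop_atTop (R := ℝ)).eventually_gt_atTop
            (-(g j₀ - η * j₀) / (η / 2))] with i hi hi0 hi1
        rw [div_lt_iff₀ (by exact_mod_cast hi0)] at hi
        rw [div_lt_iff₀ (by positivity)] at hi1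
        linarith
      obtain ⟨B, hB⟩ := eventually_atTop.1 hev
      refine (finite_Iio B).subset fun i hi => ?_
      by_contra hiB
      exact absurd hi.2 (not_le.2 (hB i (not_lt.1 hiB)))
    -- The small slope `η` makes the maximum over `i ≥ M` exist, by sublinear growth. Since `η ≤ ε`,
    -- the escape from a maximizer increases `g i - η * i`, so it must land in the block before `M`,
    -- where `g ≤ G`.
    obtain ⟨j, ⟨hjM, hj⟩, hmax⟩ := Set.exists_max_image _ (fun i : ℕ => g i - η * i) hfin
      ⟨j₀, hj₀, le_rfl⟩
    obtain ⟨i, hij, hi⟩ := h j (hM.trans hjM)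
    have h1 : η * ((i : ℝ) - j) ≤ ε * |(i : ℝ) - j| :=
      (mul_le_mul_of_nonneg_left (le_abs_self _) hη.le).trans
        (mul_le_mul_of_nonneg_right hηε (abs_nonneg _))
    by_cases hiM : M ≤ i
    · have := hmax i ⟨hiM, by linarith⟩
      linarith
    · have h2 := hG i (by omega) (by omega)
      have h3 : 0 ≤ η * i := by positivity
      linarith
  obtain ⟨G, hG⟩ := ((finite_Iio N).image g).bddAbove
  have hk (k : ℕ) : ∀ j, k * N ≤ j → j < (k + 1) * N → g j ≤ G - k * ε := by
    induction k with
    | zero => intro j _ hj; simpa using hG (mem_image_of_mem g (by simpa using hj))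
    | succ k ih =>
      intro j hj _
      have := claim ((k + 1) * N) (by nlinarith) (G - k * ε)
        (fun i hi hi' => ih i (by rw [add_mul, one_mul] at hi; omega) hi') j hj
      push_cast
      linarith
  obtain ⟨k, hk'⟩ := exists_nat_gt (G / ε)
  rw [div_lt_iff₀ hε] at hk'
  have := hk k (k * N) le_rfl (by nlinarith)
  linarith [h0 (k * N)]

/-- Finitely many strict inequalities leave room for a uniform slope and gap, the `ε` of
`false_of_escape`. -/
theorem exists_margin {w : Plane} {F : Finset (ℤ × ℤ)} (hF : ∀ f ∈ F, area w f < 0) :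
    ∃ ε : ℝ, 0 < ε ∧ ∀ f ∈ F, area w f + ε * |(f.2 : ℝ)| + ε ≤ 0 := by
  have : ∀ᶠ ε : ℝ in 𝓝[>] 0, ∀ f ∈ F, area w f + ε * |(f.2 : ℝ)| + ε ≤ 0 := by
    rw [Filter.eventually_all_finset]
    intro f hf
    have hc : Continuous fun ε : ℝ => area w f + ε * |(f.2 : ℝ)| + ε := by fun_prop
    have := (hc.tendsto 0).eventually_lt_const (u := 0) (by simpa using hF f hf)
    exact (this.filter_mono nhdsWithin_le_nhds).mono fun ε h => h.le
  obtain ⟨ε, h1, h2⟩ := (this.and self_mem_nhdsWithin).exists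
  exact ⟨ε, h2, h1⟩

theorem exists_height_bound (F : Finset (ℤ × ℤ)) : ∃ N : ℕ, 0 < N ∧ ∀ f ∈ F, |f.2| ≤ N := by
  obtain ⟨N, hN⟩ := (F.finite_toSet.image fun f => f.2.natAbs).bddAbove
  refine ⟨N + 1, by omega, fun f hf => ?_⟩
  have : f.2.natAbs ≤ N := hN (mem_image_of_mem (fun f : ℤ × ℤ => f.2.natAbs) hf)
  rw [Int.abs_eq_natAbs]
  omega

section Spacetime

variable {A : Type*} [TopologicalSpace A] {X : Subshift A ℤ}

theorem row_eq_iterate {φ : Endo X} {z : ℤ × ℤ → A} (hz : z ∈ spacetimeSet φ) {x : X.carrier}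
    (hx : row z 0 = x) (n : ℕ) : row z n = φ.toFun^[n] x := by
  induction n with
  | zero => simpa using hx
  | succ n ih =>
    obtain ⟨y, hy, hy'⟩ := hz n
    have : y = φ.toFun^[n] x := Subtype.ext (by rw [← hy, ih])
    push_cast
    rw [hy', this, Function.iterate_succ_apply']

/-- Iterates of `φ` give the future rows, and iterates of a right inverse give a choice of past
rows. -/
theorem exists_mem_spacetimeSet (φ : Endo X) (x : X.carrier) :
    ∃ z ∈ spacetimeSet φ, row z 0 = x := by
  let s := Function.surjInv φ.surjective
  let r : ℤ → X.carrier
    | Int.ofNat n => φ.toFun^[n] x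
    | Int.negSucc n => s^[n + 1] x
  have hr (j : ℤ) : r (j + 1) = φ.toFun (r j) := by
    rcases j with n | n
    · exact Function.iterate_succ_apply' _ _ _
    · have h1 : φ.toFun (r (Int.negSucc n)) = s^[n] x := by
        change φ.toFun (s^[n + 1] x) = _
        rw [Function.iterate_succ_apply', Function.surjInv_eq φ.surjective]
      rw [h1]
      rcases n with _ | n
      · rfl
      · rw [show Int.negSucc (n + 1) + 1 = Int.negSucc n by omega]
  refine ⟨fun v => (r v.2 : ℤ → A) v.1, fun j => ⟨r j, rfl, ?_⟩, rfl⟩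
  rw [← hr]
  rfl

variable [Finite A] [DiscreteTopology A] {φ : Endo X}

theorem codes_spacetime {n : ℕ} {P : Set ℤ} {m : ℤ} (h : MapCodes φ.toFun^[n] P {m}) :
    Codes (spacetime φ) {v | v.1 ∈ P ∧ v.2 = 0} {(m, (n : ℤ))} := by
  intro z hz z' hz' hzz
  obtain ⟨x, hx, -⟩ := hz 0
  obtain ⟨y, hy, -⟩ := hz' 0
  have h1 := h x y fun i hi => by
    rw [← hx, ← hy]
    exact hzz (show (i, (0 : ℤ)).1 ∈ P ∧ _ from ⟨hi, rfl⟩)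
  rintro _ rfl
  have h2 := h1 (mem_singleton m)
  rw [← row_eq_iterate hz hx, ← row_eq_iterate hz' hy] at h2
  exact h2

section Infinite

variable (hX : X.carrier.Infinite) (φ : Endo X)
include hX

/-- The half of row `0` on the nonpositive side of `w` is the left half if `w 1 < 0`, the right half
if `w 1 > 0`, and the whole row if `w 1 = 0`. For suitable `n` it codes `(W⁻(n), n)`, `(W⁺(n), n)`
or `(0, 1)` respectively, a point strictly on the positive side. -/
theorem isExpansiveRay_of_cone {w : Plane} (h1 : alphaMinus φ * w 1 < w 0)
    (h2 : alphaPlus φ * w 1 < w 0) : IsExpansiveRay (spacetime φ) w := by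
  have hw : w ≠ 0 := by
    rintro rfl
    simp at h1
  rcases lt_trichotomy (w 1) 0 with hneg | h0 | hpos
  · have ha : w 0 / w 1 < alphaMinus φ := by rw [div_lt_iff_of_neg hneg]; exact h1
    obtain ⟨n, hn, hn0⟩ := (((coneWellDefined hX φ).tendsto_minus.eventually_const_lt ha).and
      (eventually_gt_atTop 0)).exists
    rw [lt_div_iff₀ (Nat.cast_pos.2 hn0), div_mul_eq_mul_div, div_lt_iff_of_neg hneg] at hn
    refine isExpansiveRay_of_codes hw (c := 0) (p := (Wminus φ n, n)) ?_
      ((codes_spacetime (MapCodes.mono (isGreatest_Wminus hX φ n).1 subset_rfl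
        (show {Wminus φ n} ⊆ Iic (Wminus φ n) by simp))).mono ?_ subset_rfl)
    · simp only [area, Int.cast_natCast]
      linarith
    · rintro ⟨i, j⟩ ⟨hi, hj⟩
      simp only [mem_Iic] at hi hj
      subst hj
      have : (i : ℝ) ≤ 0 := by exact_mod_cast hi
      simp only [area, mem_ofPred_eq, Int.cast_zero]
      nlinarith
  · refine isExpansiveRay_of_codes hw (c := 0) (p := (0, 1)) ?_
      ((codes_spacetime (n := 1) (P := univ) (m := 0) fun x y hxy => ?_).mono ?_ subset_rfl)
    · simp only [area, h0] at h1 ⊢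
      simpa using h1
    · rw [show x = y from Subtype.ext (funext fun i => hxy (mem_univ i))]
      exact eqOn_refl _ _
    · rintro ⟨i, j⟩ ⟨-, hj⟩
      simp only at hj
      simp [area, h0, hj]
  · have ha : alphaPlus φ < w 0 / w 1 := by rw [lt_div_iff₀ hpos]; exact h2
    obtain ⟨n, hn, hn0⟩ := (((coneWellDefined hX φ).tendsto_plus.eventually_lt_const ha).and
      (eventually_gt_atTop 0)).exists
    rw [div_lt_iff₀ (by exact_mod_cast hn0), div_mul_eq_mul_div, lt_div_iff₀ hpos] at hn
    refine isExpansiveRay_of_codes hw (c := 0) (p := (Wplus φ n, n)) ?_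
      ((codes_spacetime (MapCodes.mono (isLeast_Wplus hX φ n).1 subset_rfl
        (show {Wplus φ n} ⊆ Ici (Wplus φ n) by simp))).mono ?_ subset_rfl)
    · simp only [area, Int.cast_natCast]
      linarith
    · rintro ⟨i, j⟩ ⟨hi, hj⟩
      simp only [mem_Ici] at hi hj
      subst hj
      have : (0 : ℝ) ≤ i := by exact_mod_cast hi
      simp only [area, mem_ofPred_eq, Int.cast_zero]
      nlinarith

theorem not_isExpansiveRay_alphaPlus : ¬ IsExpansiveRay (spacetime φ) !₂[alphaPlus φ, 1] := by
  intro he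
  obtain ⟨F, hF, hc⟩ := he.exists_finset (fun h => by
    simpa using congrArg (fun p : Plane => p 1) h)
  obtain ⟨ε, hε, hεF⟩ := exists_margin hF
  obtain ⟨N, hN, hNF⟩ := exists_height_bound F
  refine false_of_escape (g := fun j => (Wplus φ j : ℝ) - alphaPlus φ * j)
    (fun j => by linarith [alphaPlus_mul_le hX φ j]) ?_ hN hε fun j hj => ?_
  · have := (coneWellDefined hX φ).tendsto_plus.sub_const (alphaPlus φ)
    rw [sub_self] at this
    refine this.congr' ?_
    filter_upwards [eventually_gt_atTop 0] with j hj
    have : (j : ℝ) ≠ 0 := by positivity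
    field_simp
  -- Otherwise every point of `F` translated to `(W⁺(j) - 1, j)` is coded by the right half of row
  -- `0`, hence so is that point, against the minimality of `W⁺(j)`. Taking `j ≥ N` keeps the rows
  -- involved nonnegative, so `toNat` is harmless.
  · obtain ⟨f, hf, hfW⟩ : ∃ f ∈ F, Wplus φ j + f.1 ≤ Wplus φ (j + f.2).toNat := by
      by_contra! hcon
      have hmem : Wplus φ j - 1 ∈ rightCoded φ j := by
        intro x y hxy i hi
        simp only [mem_Ici] at hi
        by_cases hi' : Wplus φ j ≤ i
        · exact (isLeast_Wplus hX φ j).1 x y hxy hi'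
        obtain rfl : i = Wplus φ j - 1 := by omega
        obtain ⟨z, hz, hzx⟩ := exists_mem_spacetimeSet φ x
        obtain ⟨z', hz', hzy⟩ := exists_mem_spacetimeSet φ y
        rw [← row_eq_iterate hz hzx, ← row_eq_iterate hz' hzy]
        have := hc.point ⟨z, hz⟩ ⟨z', hz'⟩ (Wplus φ j - 1, j) fun f hf => ?_
        · simpa [row] using this
        have h1 := hcon f hf
        have h2 := abs_le.1 (hNF f hf)
        have h3 : ((j + f.2).toNat : ℤ) = j + f.2 := by omega
        have h4 := (isLeast_Wplus hX φ (j + f.2).toNat).1 x y hxy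
          (show Wplus φ j - 1 + f.1 ∈ Ici _ by simp only [mem_Ici]; omega)
        rw [← row_eq_iterate hz hzx, ← row_eq_iterate hz' hzy, h3] at h4
        exact h4
      have := (isLeast_Wplus hX φ j).2 hmem
      omega
    have h2 := abs_le.1 (hNF f hf)
    have h3 : ((j + f.2).toNat : ℤ) = j + f.2 := by omega
    have h4 : (((j + f.2).toNat : ℕ) : ℝ) = j + f.2 := by exact_mod_cast h3
    refine ⟨(j + f.2).toNat, by omega, ?_⟩
    have h5 := hεF f hf
    have h6 : (Wplus φ j : ℝ) + f.1 ≤ Wplus φ (j + f.2).toNat := by exact_mod_cast hfW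
    simp [area] at h5
    simp only [h4, add_sub_cancel_left]
    linarith

theorem not_isExpansiveRay_alphaMinus :
    ¬ IsExpansiveRay (spacetime φ) !₂[-alphaMinus φ, -1] := by
  intro he
  obtain ⟨F, hF, hc⟩ := he.exists_finset (fun h => by
    simpa using congrArg (fun p : Plane => p 1) h)
  obtain ⟨ε, hε, hεF⟩ := exists_margin hF
  obtain ⟨N, hN, hNF⟩ := exists_height_bound F
  refine false_of_escape (g := fun j => alphaMinus φ * j - (Wminus φ j : ℝ))
    (fun j => by linarith [le_alphaMinus_mul hX φ j]) ?_ hN hε fun j hj => ?_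
  · have := (coneWellDefined hX φ).tendsto_minus.const_sub (alphaMinus φ)
    rw [sub_self] at this
    refine this.congr' ?_
    filter_upwards [eventually_gt_atTop 0] with j hj
    have : (j : ℝ) ≠ 0 := by positivity
    field_simp
  · obtain ⟨f, hf, hfW⟩ : ∃ f ∈ F, Wminus φ (j + f.2).toNat ≤ Wminus φ j + f.1 := by
      by_contra! hcon
      have hmem : Wminus φ j + 1 ∈ leftCoded φ j := by
        intro x y hxy i hi
        simp only [mem_Iic] at hi
        by_cases hi' : i ≤ Wminus φ j
        · exact (isGreatest_Wminus hX φ j).1 x y hxy hi'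
        obtain rfl : i = Wminus φ j + 1 := by omega
        obtain ⟨z, hz, hzx⟩ := exists_mem_spacetimeSet φ x
        obtain ⟨z', hz', hzy⟩ := exists_mem_spacetimeSet φ y
        rw [← row_eq_iterate hz hzx, ← row_eq_iterate hz' hzy]
        have := hc.point ⟨z, hz⟩ ⟨z', hz'⟩ (Wminus φ j + 1, j) fun f hf => ?_
        · simpa [row] using this
        have h1 := hcon f hf
        have h2 := abs_le.1 (hNF f hf)
        have h3 : ((j + f.2).toNat : ℤ) = j + f.2 := by omega
        have h4 := (isGreatest_Wminus hX φ (j + f.2).toNat).1 x y hxy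
          (show Wminus φ j + 1 + f.1 ∈ Iic _ by simp only [mem_Iic]; omega)
        rw [← row_eq_iterate hz hzx, ← row_eq_iterate hz' hzy, h3] at h4
        exact h4
      have := (isGreatest_Wminus hX φ j).2 hmem
      omega
    have h2 := abs_le.1 (hNF f hf)
    have h3 : ((j + f.2).toNat : ℤ) = j + f.2 := by omega
    have h4 : (((j + f.2).toNat : ℕ) : ℝ) = j + f.2 := by exact_mod_cast h3
    refine ⟨(j + f.2).toNat, by omega, ?_⟩
    have h5 := hεF f hf
    have h6 : (Wminus φ (j + f.2).toNat : ℝ) ≤ Wminus φ j + f.1 := by exact_mod_cast hfW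
    simp [area] at h5
    simp only [h4, add_sub_cancel_left]
    linarith

end Infinite

end Spacetime

/-! ### Cones in the circle of rays -/

/-- The ray spanned by a nonzero vector. -/
noncomputable def normRay (v : Plane) (hv : v ≠ 0) : RayCircle :=
  ⟨‖v‖⁻¹ • v, by
    rw [mem_sphere_zero_iff_norm, norm_smul, norm_inv, norm_norm,
      inv_mul_cancel₀ (norm_ne_zero_iff.2 hv)]⟩

theorem coe_normRay (v : Plane) (hv : v ≠ 0) : (normRay v hv : Plane) = ‖v‖⁻¹ • v := rfl

theorem coe_ne_zero (ρ : RayCircle) : (ρ : Plane) ≠ 0 := ne_zero_of_mem_unit_sphere ρ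

theorem continuous_normRay {S : Type*} [TopologicalSpace S] {f : S → Plane} (hf : Continuous f)
    (h0 : ∀ s, f s ≠ 0) : Continuous fun s => normRay (f s) (h0 s) :=
  Continuous.subtype_mk ((hf.norm.inv₀ fun s => norm_ne_zero_iff.2 (h0 s)).smul hf) _

/-- This is the radial projection of a convex cone; at least one strict inequality is needed to
exclude the origin. -/
theorem isPreconnected_cone {ι : Type*} [Nonempty ι] (a b : ι → ℝ) :
    IsPreconnected {ρ : RayCircle | ∀ i, 0 < a i * ρ.1 0 + b i * ρ.1 1} := by
  let V : Set Plane := {v | ∀ i, 0 < a i * v 0 + b i * v 1}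
  have hV : Convex ℝ V := by
    intro x hx y hy s t hs ht hst i
    have h1 := hx i
    have h2 := hy i
    have : a i * (s • x + t • y) 0 + b i * (s • x + t • y) 1 =
        s * (a i * x 0 + b i * x 1) + t * (a i * y 0 + b i * y 1) := by
      simp
      ring
    rw [this]
    rcases hs.eq_or_lt with rfl | hs
    · rw [zero_add] at hst
      subst hst
      simpa using h2
    · have := mul_pos hs h1
      have := mul_nonneg ht h2.le
      linarith
  have hV0 (v : V) : (v : Plane) ≠ 0 := by
    intro h
    have := v.2 (Classical.arbitrary ι)
    simp [h] at this
  have : PreconnectedSpace V := Subtype.preconnectedSpace hV.isPreconnected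
  convert! isPreconnected_range (continuous_normRay (continuous_subtype_val (p := (· ∈ V))) hV0)
    using 1
  ext ρ
  constructor
  · intro h
    refine ⟨⟨ρ, h⟩, Subtype.ext ?_⟩
    rw [coe_normRay]
    simp
  · rintro ⟨v, rfl⟩ i
    have h1 := v.2 i
    have h2 : 0 < ‖(v : Plane)‖⁻¹ := inv_pos.2 (norm_pos_iff.2 (hV0 v))
    simp only [coe_normRay, PiLp.smul_apply, smul_eq_mul]
    nlinarith [mul_pos h2 h1]

theorem area_smul (t : ℝ) (w : Plane) (z : ℤ × ℤ) : area (t • w) z = t * area w z := by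
  simp only [area, PiLp.smul_apply, smul_eq_mul]
  ring

theorem IsExpansiveRay.smul {A : Type*} [TopologicalSpace A] [Finite A] [DiscreteTopology A]
    {Y : Subshift A (ℤ × ℤ)} {w : Plane} (hw : w ≠ 0) (h : IsExpansiveRay Y w) {t : ℝ}
    (ht : 0 < t) : IsExpansiveRay Y (t • w) := by
  obtain ⟨F, hF, hc⟩ := h.exists_finset hw
  exact isExpansiveRay_of_finset (smul_ne_zero ht.ne' hw)
    (fun f hf => by rw [area_smul]; exact mul_neg_of_pos_of_neg ht (hF f hf)) hc

/-- An open cone of directions contains a primitive lattice vector. -/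
theorem exists_primitive {F : Finset (ℤ × ℤ)} (hne : F.Nonempty) {w : Plane}
    (hw : ∀ f ∈ F, area w f < 0) :
    ∃ m n a b : ℤ, a * m + b * n = 1 ∧ ∀ f ∈ F, area (toPlane (m, n)) f < 0 := by
  -- A rational point of this open cone becomes primitive after clearing denominators and dividing
  -- by the gcd, both positive rescalings.
  let U : Set (ℝ × ℝ) := ⋂ f ∈ F, {v | v.1 * (f.2 : ℝ) - v.2 * f.1 < 0}
  have hU : IsOpen U := isOpen_biInter_finset fun f _ =>
    isOpen_lt (by fun_prop) continuous_const
  obtain ⟨⟨q, r⟩, hqr⟩ := ((Rat.denseRange_cast (𝕜 := ℝ)).prodMap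
    (Rat.denseRange_cast (𝕜 := ℝ))).exists_mem_open hU ⟨(w 0, w 1), mem_iInter₂.2 hw⟩
  have hqr' (f) (hf : f ∈ F) : (q : ℝ) * (f.2 : ℝ) - r * f.1 < 0 := mem_iInter₂.1 hqr f hf
  have hq0 : (0 : ℝ) < q.den := by exact_mod_cast q.den_pos
  have hr0 : (0 : ℝ) < r.den := by exact_mod_cast r.den_pos
  have hq : (q : ℝ) * q.den = q.num := by exact_mod_cast Rat.mul_den_eq_num q
  have hr : (r : ℝ) * r.den = r.num := by exact_mod_cast Rat.mul_den_eq_num r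
  have hI (f) (hf : f ∈ F) :
      ((q.num * r.den : ℤ) : ℝ) * f.2 - ((r.num * q.den : ℤ) : ℝ) * f.1 < 0 := by
    push_cast
    rw [← hq, ← hr]
    have := mul_neg_of_pos_of_neg (mul_pos hq0 hr0) (hqr' f hf)
    linarith
  have hg : 0 < (q.num * r.den).gcd (r.num * q.den) := by
    rw [Int.gcd_pos_iff]
    by_contra! hcon
    obtain ⟨f, hf⟩ := hne
    have := hI f hf
    rw [hcon.1, hcon.2] at this
    simp at this
  obtain ⟨d, m, n, hd, hmn, hm, hn⟩ := Int.exists_gcd_one' hg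
  obtain ⟨a, b, hab⟩ := Int.isCoprime_iff_gcd_eq_one.2 hmn
  refine ⟨m, n, a, b, hab, fun f hf => ?_⟩
  have h1 := hI f hf
  have h2 : (0 : ℝ) < d := by exact_mod_cast hd
  rw [hm, hn] at h1
  push_cast at h1
  by_contra! h4
  have h5 : (0 : ℝ) ≤ m * f.2 - n * f.1 := by simpa [area, toPlane] using h4
  have := mul_nonneg h2.le h5
  linarith

/-- The arc of the circle around an expansive ray contained in the expansive rays contains a
rational ray. -/
theorem exists_rational_mem_component {A : Type*} [TopologicalSpace A] [Finite A]
    [DiscreteTopology A] {Y : Subshift A (ℤ × ℤ)} {ρ : RayCircle} (hρ : ρ ∈ expansiveRays Y) :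
    ∃ m n a b : ℤ, a * m + b * n = 1 ∧ IsExpansiveRay Y (toPlane (m, n)) ∧
      ∃ ρ₀ ∈ connectedComponentIn (expansiveRays Y) ρ, ∃ t : ℝ, 0 < t ∧
        (ρ₀ : Plane) = t • toPlane (m, n) := by
  classical
  obtain ⟨F₀, hF₀, hc₀⟩ := IsExpansiveRay.exists_finset (coe_ne_zero ρ) hρ
  obtain ⟨u, hu⟩ := exists_lt_area (coe_ne_zero ρ) 0
  -- The certificate may be empty; the extra point makes it nonempty, so that directions with `F` on
  -- the negative side are nonzero.
  let F := insert (-u) F₀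
  have hF : ∀ f ∈ F, area ρ f < 0 := by
    intro f hf
    rcases Finset.mem_insert.1 hf with rfl | hf
    · rw [area_neg]; linarith
    · exact hF₀ f hf
  have hc : Codes Y F {0} := hc₀.mono (by simp [F]) subset_rfl
  have hne : F.Nonempty := ⟨-u, Finset.mem_insert_self _ _⟩
  have hexp {w : Plane} (hw : ∀ f ∈ F, area w f < 0) : w ≠ 0 ∧ IsExpansiveRay Y w := by
    have h0 : w ≠ 0 := by
      rintro rfl
      obtain ⟨f, hf⟩ := hne
      have := hw f hf
      simp [area] at this
    exact ⟨h0, isExpansiveRay_of_finset h0 hw hc⟩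
  obtain ⟨m, n, a, b, hab, hmn⟩ := exists_primitive hne hF
  have h0 := (hexp hmn).1
  have ht : 0 < ‖toPlane (m, n)‖⁻¹ := inv_pos.2 (norm_pos_iff.2 h0)
  refine ⟨m, n, a, b, hab, (hexp hmn).2, normRay _ h0, ?_, _, ht, rfl⟩
  have : Nonempty F := hne.to_subtype
  have hmem (σ : RayCircle) :
      σ ∈ {ρ : RayCircle | ∀ f : F, 0 < -(f.1.2 : ℝ) * ρ.1 0 + (f.1.1 : ℝ) * ρ.1 1} ↔
        ∀ f ∈ F, area σ f < 0 := by
    simp only [mem_ofPred_eq, Subtype.forall, area]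
    refine forall₂_congr fun f hf => ?_
    constructor <;> intro h <;> linarith
  refine (isPreconnected_cone (fun f : F => -(f.1.2 : ℝ)) fun f : F =>
    (f.1.1 : ℝ)).subset_connectedComponentIn ((hmem ρ).2 hF)
    (fun σ hσ => (hexp ((hmem σ).1 hσ)).2) ((hmem _).2 fun f hf => ?_)
  rw [coe_normRay, area_smul]
  exact mul_neg_of_pos_of_neg ht (hmn f hf)

theorem frontier_component_of_finite {A : Type*} [TopologicalSpace A] [Finite A]
    [DiscreteTopology A] {Y : Subshift A (ℤ × ℤ)} (hY : Y.carrier.Finite) (ρ : RayCircle) :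
    frontier (connectedComponentIn (expansiveRays Y) ρ) = ∅ := by
  have hE : expansiveRays Y = univ :=
    eq_univ_of_forall fun σ => isExpansiveRay_of_finite hY (coe_ne_zero σ)
  have : PreconnectedSpace RayCircle := Subtype.preconnectedSpace (isPreconnected_sphere (by
    rw [← Module.finrank_eq_rank, finrank_euclideanSpace_fin]; norm_num) _ _)
  rw [hE, connectedComponentIn_univ, PreconnectedSpace.connectedComponent_eq_univ, frontier_univ]

theorem span_mapRay {A B : Type*} [TopologicalSpace A] [TopologicalSpace B]
    {Y : Subshift A (ℤ × ℤ)} {Z : Subshift B (ℤ × ℤ)} (Ψ : Z2Iso Y Z) (ρ : RayCircle) :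
    Submodule.span ℝ (Ψ.mapRay ρ) = Submodule.span ℝ {planeMap Ψ.basisChange ρ} := by
  apply le_antisymm
  · rw [Submodule.span_le]
    rintro _ ⟨_, ⟨t, -, rfl⟩, rfl⟩
    rw [planeMap_smul]
    exact Submodule.smul_mem _ _ (Submodule.mem_span_singleton_self _)
  · rw [Submodule.span_le, singleton_subset_iff]
    exact Submodule.subset_span ⟨ρ, ⟨1, zero_le_one, by simp⟩, rfl⟩

/-! ### The component as a cone, and its edges -/

section Edges

variable {A B : Type*} [TopologicalSpace A] [TopologicalSpace B]
  [Finite B] [DiscreteTopology B] {Y : Subshift A (ℤ × ℤ)} {X : Subshift B ℤ} {φ : Endo X}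

/-- The rays that `Ψ` maps into the open cone of directions bounded by the rays of `(α⁺, 1)` and
`-(α⁻, 1)`. -/
def coneRays (Ψ : Z2Iso Y (spacetime φ)) : Set RayCircle :=
  {ρ | alphaMinus φ * planeMap Ψ.basisChange ρ 1 < planeMap Ψ.basisChange ρ 0 ∧
    alphaPlus φ * planeMap Ψ.basisChange ρ 1 < planeMap Ψ.basisChange ρ 0}

variable {Ψ : Z2Iso Y (spacetime φ)}

theorem isPreconnected_coneRays : IsPreconnected (coneRays Ψ) := by
  let M : Matrix (Fin 2) (Fin 2) ℤ := Ψ.basisChange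
  let c : Bool → ℝ := fun i => bif i then alphaPlus φ else alphaMinus φ
  convert! isPreconnected_cone (fun i => (M 0 0 : ℝ) - c i * M 1 0)
    (fun i => (M 0 1 : ℝ) - c i * M 1 1) using 1
  ext ρ
  simp only [coneRays, mem_ofPred_eq, Bool.forall_bool, c, cond_true, cond_false, planeMap, M]
  simp only [Matrix.cons_val_zero, Matrix.cons_val_one]
  constructor <;> rintro ⟨h1, h2⟩ <;> constructor <;> linarith

theorem continuous_planeMap_coe (M : Matrix (Fin 2) (Fin 2) ℤ) (i : Fin 2) :
    Continuous fun ρ : RayCircle => planeMap M ρ i :=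
  (EuclideanSpace.proj (𝕜 := ℝ) i).continuous.comp
    ((continuous_planeMap M).comp continuous_subtype_val)

theorem isOpen_coneRays : IsOpen (coneRays Ψ) := by
  have h0 := continuous_planeMap_coe Ψ.basisChange 0
  have h1 := continuous_planeMap_coe Ψ.basisChange 1
  exact (isOpen_lt (h1.const_mul _) h0).inter (isOpen_lt (h1.const_mul _) h0)

theorem closure_coneRays_subset : closure (coneRays Ψ) ⊆
    {ρ | alphaMinus φ * planeMap Ψ.basisChange ρ 1 ≤ planeMap Ψ.basisChange ρ 0 ∧
      alphaPlus φ * planeMap Ψ.basisChange ρ 1 ≤ planeMap Ψ.basisChange ρ 0} := by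
  have h0 := continuous_planeMap_coe Ψ.basisChange 0
  have h1 := continuous_planeMap_coe Ψ.basisChange 1
  refine closure_minimal (fun ρ h => ⟨h.1.le, h.2.le⟩) ?_
  exact (isClosed_le (h1.const_mul _) h0).inter (isClosed_le (h1.const_mul _) h0)

theorem plane_eq_smul {v : Plane} {a b t : ℝ} (h0 : v 0 = t * a) (h1 : v 1 = t * b) :
    v = t • !₂[a, b] := by
  ext i
  fin_cases i <;> simp [h0, h1]

/-- As `α⁻ ≤ α⁺`, the binding inequality is the one for `α⁺` when `v > 0` and the one for `α⁻` when
`v < 0`; on the axis `v = 0` only the zero vector could be on the boundary. -/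
theorem frontier_coneRays (hX : X.carrier.Infinite) {ρ : RayCircle}
    (hρ : ρ ∈ frontier (coneRays Ψ)) : ∃ t : ℝ, 0 < t ∧
      (planeMap Ψ.basisChange ρ = t • !₂[alphaPlus φ, 1] ∨
        planeMap Ψ.basisChange ρ = t • !₂[-alphaMinus φ, -1]) := by
  rw [isOpen_coneRays.frontier_eq] at hρ
  obtain ⟨h1, h2⟩ := closure_coneRays_subset hρ.1
  have h3 := hρ.2
  have hα := alphaMinus_le_alphaPlus hX φ
  have hv := planeMap_ne_zero Ψ.basisChange (coe_ne_zero ρ)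
  simp only [coneRays, mem_ofPred_eq] at h3
  generalize planeMap Ψ.basisChange ρ = v at *
  rcases lt_trichotomy (v 1) 0 with hneg | h0 | hpos
  · have he : v 0 = alphaMinus φ * v 1 := by
      apply le_antisymm _ h1
      by_contra! hcon
      exact h3 ⟨hcon, by nlinarith⟩
    exact ⟨-v 1, by linarith, Or.inr (plane_eq_smul (by rw [he]; ring) (by ring))⟩
  · simp only [h0, mul_zero] at h1 h3
    refine absurd (plane_eq_smul (v := v) (a := 0) (b := 0) (t := 0) ?_ (by simp [h0])) ?_
    · by_contra hne
      rw [zero_mul] at hne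
      have : 0 < v 0 := lt_of_le_of_ne h1 (Ne.symm hne)
      exact h3 ⟨this, this⟩
    · rwa [zero_smul]
  · have he : v 0 = alphaPlus φ * v 1 := by
      apply le_antisymm _ h2
      by_contra! hcon
      exact h3 ⟨by nlinarith, hcon⟩
    exact ⟨v 1, hpos, Or.inl (plane_eq_smul (by rw [he]; ring) (by ring))⟩

/-- A vector on an edge spans a ray in the frontier of the cone. -/
theorem exists_mem_frontier_coneRays {e : Plane} (h1 : e 1 ≠ 0)
    (hm : alphaMinus φ * e 1 ≤ e 0) (hp : alphaPlus φ * e 1 ≤ e 0)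
    (heq : e 0 = alphaMinus φ * e 1 ∨ e 0 = alphaPlus φ * e 1) :
    ∃ ρ ∈ frontier (coneRays Ψ), ∃ t : ℝ, t ≠ 0 ∧ planeMap Ψ.basisChange ρ = t • e := by
  -- Moving an edge vector to the right enters the cone at once, so its ray is a limit of rays of
  -- the cone.
  let f : ℝ → Plane := fun s => e + s • !₂[1, 0]
  have hf : Continuous f := by fun_prop
  have hf0 (s : ℝ) : f s 0 = e 0 + s := by simp [f]
  have hf1 (s : ℝ) : f s 1 = e 1 := by simp [f]
  have hne (s : ℝ) : f s ≠ 0 := by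
    intro h
    rw [← hf1 s, h] at h1
    simp at h1
  let g : ℝ → Plane := fun s => planeMap (Ψ.basisChange⁻¹ : GL (Fin 2) ℤ) (f s)
  have hg : Continuous g := (continuous_planeMap _).comp hf
  have hgne (s : ℝ) : g s ≠ 0 := planeMap_ne_zero _ (hne s)
  have hMg (s : ℝ) : planeMap Ψ.basisChange (normRay (g s) (hgne s)) = ‖g s‖⁻¹ • f s := by
    rw [coe_normRay, planeMap_smul, planeMap_cancel_inv]
  have hpos (s : ℝ) : 0 < ‖g s‖⁻¹ := inv_pos.2 (norm_pos_iff.2 (hgne s))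
  have hmem (s : ℝ) : normRay (g s) (hgne s) ∈ coneRays Ψ ↔
      alphaMinus φ * e 1 < e 0 + s ∧ alphaPlus φ * e 1 < e 0 + s := by
    simp only [coneRays, mem_ofPred_eq, hMg, PiLp.smul_apply, smul_eq_mul, hf0, hf1]
    rw [mul_left_comm, mul_lt_mul_iff_right₀ (hpos s), mul_left_comm,
      mul_lt_mul_iff_right₀ (hpos s)]
  refine ⟨normRay (g 0) (hgne 0), ?_, ‖g 0‖⁻¹, (hpos 0).ne', by rw [hMg]; simp [f]⟩
  rw [isOpen_coneRays.frontier_eq]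
  refine ⟨?_, ?_⟩
  · have h0 : (0 : ℝ) ∈ closure (Ioi 0) := by simp
    refine closure_mono ?_ (image_closure_subset_closure_image (continuous_normRay hg hgne)
      (mem_image_of_mem _ h0))
    rintro _ ⟨s, hs, rfl⟩
    have hs' : 0 < s := hs
    exact (hmem s).2 ⟨by linarith, by linarith⟩
  · rw [hmem]
    rintro ⟨h2, h3⟩
    rcases heq with h | h <;> linarith

theorem span_smul_edge {e : Plane} {t : ℝ} (ht : t ≠ 0) :
    Submodule.span ℝ {t • e} = Submodule.span ℝ {e} :=
  Submodule.span_singleton_smul_eq (IsUnit.mk0 t ht) e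

theorem neg_edge (a : ℝ) : (!₂[-a, -1] : Plane) = (-1 : ℝ) • !₂[a, 1] := by
  ext i
  fin_cases i <;> simp

theorem image_frontier_coneRays (hX : X.carrier.Infinite) :
    (fun ρ : RayCircle => Submodule.span ℝ (Ψ.mapRay ρ)) '' frontier (coneRays Ψ) =
      lightConeEdges φ := by
  have hα := alphaMinus_le_alphaPlus hX φ
  apply Subset.antisymm
  · rintro _ ⟨ρ, hρ, rfl⟩
    obtain ⟨t, ht, h | h⟩ := frontier_coneRays hX hρ
    · exact Or.inr (by simp only [mem_singleton_iff]; rw [span_mapRay, h, span_smul_edge ht.ne'])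
    · exact Or.inl (by
        change Submodule.span ℝ (Ψ.mapRay ρ) = _
        rw [span_mapRay, h, span_smul_edge ht.ne', neg_edge,
        span_smul_edge (by norm_num)])
  · rintro _ (rfl | rfl)
    · obtain ⟨ρ, hρ, t, ht, h⟩ := exists_mem_frontier_coneRays (Ψ := Ψ)
        (e := !₂[-alphaMinus φ, -1]) (by simp) (by simp) (by simpa using hα) (Or.inl (by simp))
      refine ⟨ρ, hρ, ?_⟩
      simp only
      rw [span_mapRay, h, span_smul_edge ht, neg_edge, span_smul_edge (by norm_num)]
    · obtain ⟨ρ, hρ, t, ht, h⟩ := exists_mem_frontier_coneRays (Ψ := Ψ)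
        (e := !₂[alphaPlus φ, 1]) (by simp) (by simpa using hα) (by simp) (Or.inr (by simp))
      refine ⟨ρ, hρ, ?_⟩
      simp only
      rw [span_mapRay, h, span_smul_edge ht]

variable [Finite A] [DiscreteTopology A]

/-- The cone of directions is the component of the expansive rays that it meets. -/
theorem connectedComponentIn_eq_coneRays (hX : X.carrier.Infinite) (hΨ : Ψ.OrientationPreserving)
    {ρ : RayCircle} (hρ : ρ ∈ coneRays Ψ) :
    connectedComponentIn (expansiveRays Y) ρ = coneRays Ψ := by
  have hsub : coneRays Ψ ⊆ expansiveRays Y := fun σ hσ =>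
    (Z2Iso.isExpansiveRay_iff hΨ (coe_ne_zero σ)).1 (isExpansiveRay_of_cone hX φ hσ.1 hσ.2)
  have hfr : ∀ σ ∈ frontier (coneRays Ψ), σ ∉ expansiveRays Y := by
    intro σ hσ hE
    have hE' := (Z2Iso.isExpansiveRay_iff hΨ (coe_ne_zero σ)).2 hE
    obtain ⟨t, ht, h⟩ := frontier_coneRays hX hσ
    have hsc := hE'.smul (planeMap_ne_zero _ (coe_ne_zero σ)) (inv_pos.2 ht)
    rcases h with h | h <;> rw [h, inv_smul_smul₀ ht.ne'] at hsc
    · exact not_isExpansiveRay_alphaPlus hX φ hsc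
    · exact not_isExpansiveRay_alphaMinus hX φ hsc
  apply Subset.antisymm
  -- The frontier contains no expansive ray, so the open cone and the exterior of its closure
  -- separate the expansive rays.
  · refine IsPreconnected.subset_left_of_subset_union (v := (closure (coneRays Ψ))ᶜ)
      isOpen_coneRays isClosed_closure.isOpen_compl
      (disjoint_compl_right.mono_left subset_closure) ?_
      ⟨ρ, mem_connectedComponentIn (hsub hρ), hρ⟩ isPreconnected_connectedComponentIn
    intro σ hσ
    by_cases h1 : σ ∈ coneRays Ψ
    · exact Or.inl h1
    · refine Or.inr fun h2 => hfr σ ?_ (connectedComponentIn_subset _ _ hσ)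
      rw [isOpen_coneRays.frontier_eq]
      exact ⟨h2, h1⟩
  · exact isPreconnected_coneRays.subset_connectedComponentIn hρ hsub

end Edges

end LightCone

/-! ### Assembly of the theorem -/

open LightCone in
theorem mainTheorem3 {A : Type*} [Finite A] [TopologicalSpace A] [DiscreteTopology A]
    (Y : Subshift A (ℤ × ℤ))
    (C : Set LightCone.RayCircle)
    (hC : ∃ ρ ∈ LightCone.expansiveRays Y, C = connectedComponentIn (LightCone.expansiveRays Y) ρ)
    (ρ₁ ρ₂ : LightCone.RayCircle) (hends : frontier C = {ρ₁, ρ₂}) :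
    ∃ (k : ℕ) (X : Subshift (Fin k) ℤ) (φ : LightCone.Endo X)
      (Ψ : LightCone.Z2Iso Y (LightCone.spacetime φ)),
      X.carrier.Infinite ∧ LightCone.ConeWellDefined φ ∧ Ψ.OrientationPreserving ∧
      ({Submodule.span ℝ (Ψ.mapRay ρ₁), Submodule.span ℝ (Ψ.mapRay ρ₂)} :
        Set (Submodule ℝ LightCone.Plane)) = LightCone.lightConeEdges φ := by
  obtain ⟨ρ, hρ, rfl⟩ := hC
  obtain ⟨m, n, a, b, hab, hexp, ρ₀, hρ₀, t, ht, hρt⟩ := exists_rational_mem_component hρ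
  obtain ⟨k, X, φ, Ψ, hΨ, hM⟩ := exists_spacetimeIso hab hexp
  have hX : X.carrier.Infinite := by
    intro hfin
    have h1 : Finite (spacetime φ).carrier := spacetime_finite φ hfin
    have h2 : Y.carrier.Finite := Finite.of_equiv _ Ψ.toHomeomorph.symm.toEquiv
    rw [frontier_component_of_finite h2] at hends
    exact (hends ▸ mem_insert ρ₁ {ρ₂} : ρ₁ ∈ (∅ : Set RayCircle))
  have hmem : ρ₀ ∈ coneRays Ψ := by
    simp only [coneRays, mem_ofPred_eq, hρt, planeMap_smul, hM]
    simpa using ht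
  rw [connectedComponentIn_eq hρ₀, connectedComponentIn_eq_coneRays hX hΨ hmem] at hends
  refine ⟨k, X, φ, Ψ, hX, coneWellDefined hX φ, hΨ, ?_⟩
  rw [← image_frontier_coneRays hX (Ψ := Ψ), hends, image_pair]
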